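/- Let $n,d\ge 1$ be integers and let $k=(k_1,\dots,k_l)$ be a partition of $d$, i.e. $k_i\ge 1$ and $k_1+\dots+k_l=d$. For a permutation $\sigma$ of $\{1,\dots,l\}$ let $$\mathcal P_{k,\sigma}=\{t_{\sigma(1)}\otimes\dots\otimes t_{\sigma(l)} \mid t_i\in(\mathbb C^n)^{\otimes k_i}\}\subseteq(\mathbb C^n)^{\otimes d},$$ and let $X=\bigcup_{\sigma\in\mathfrak S_l}\mathcal P_{k,\sigma}$ be the partition-rank-one variety. The $k$-partition rank of $T\in(\mathbb C^n)^{\otimes d}$ is the least $r\in\mathbb N_0$ such that $T$ is a sum of $r$ elements of $X$; the generic $k$-partition rank $r_g$ is the value that the $k$-partition rank takes on a nonempty (hence dense) Zariski-open subset of $(\mathbb C^n)^{\otimes d}$. For subsets $Y_1,\dots,Y_r$ of a finite-dimensional complex vector space $V$, the join $J(Y_1,\dots,Y_r)$ is the Zariski closure of $\{y_1+\dots+y_r\mid y_j\in Y_j\}$. The set $X$ is called $r$-nondefective if for every choice of $r$ irreducible components $Y_1,\dots,Y_r$ of $X$ (repetitions allowed) the dimension of $J(Y_1,\dots,Y_r)$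 is not smaller than the expected one, $\min\{\dim Y_1+\dots+\dim Y_r,\ \dim V\}$. **Theorem.** Put $c=n^{k_1}+\dots+n^{k_l}-l+1$. Then the generic $k$-partition rank $r_g$ of $(\mathbb C^n)^{\otimes d}$ exists and satisfies $$r_g\le \frac{n^d}{c}+c .$$ Moreover, $X$ is $r$-nondefective for every $r\in\mathbb N_0$ with $$r<\frac{n^d}{c}-c .$$ -/

import Mathlib

open scoped TensorProduct Topology

section AffineVarieties

variable (V : Type*) [AddCommGroup V] [Module ℂ V]

/-- The complex polynomial functions on a vector space `V`: the algebra of functions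
generated by the linear functionals. -/
def polynomialFunctionAlgebra : Subalgebra ℂ (V → ℂ) :=
  Algebra.adjoin ℂ (Set.range fun φ : Module.Dual ℂ V => (φ : V → ℂ))

/-- The Zariski topology on `V`, with the nonvanishing loci of polynomial functions as
basic open sets. -/
@[reducible] def zariskiTopology : TopologicalSpace V :=
  TopologicalSpace.generateFrom {U | ∃ f ∈ polynomialFunctionAlgebra V, U = {v | f v ≠ 0}}

variable {V}

/-- The Zariski closure of a subset of `V`. -/
def zariskiClosure (Z : Set V) : Set V := @closure V (zariskiTopology V) Z

/-- The coordinate ring of a subset `Z` of `V`: the restrictions to `Z` of the polynomial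
functions. -/
def coordinateRing (Z : Set V) : Subalgebra ℂ (Z → ℂ) :=
  Algebra.adjoin ℂ (Set.range fun φ : Module.Dual ℂ V => fun z : Z => φ z)

/-- The dimension of (the Zariski closure of) `Z`, as the Krull dimension of its coordinate
ring. -/
noncomputable def varietyDim (Z : Set V) : WithBot ℕ∞ := ringKrullDim (coordinateRing Z)

/-- `Z` is an irreducible component of `X`: a maximal Zariski-irreducible subset of `X`. -/
def IsComponentOf (Z X : Set V) : Prop :=
  Maximal (fun Y : Set V => Y ⊆ X ∧ @IsIrreducible V (zariskiTopology V) Y) Z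

/-- The join `J(Y_1, …, Y_r)`: the Zariski closure of the set of all sums `y_1 + … + y_r`
with `y_j ∈ Y_j`. -/
def varietyJoin {r : ℕ} (Y : Fin r → Set V) : Set V :=
  zariskiClosure {v | ∃ y : Fin r → V, (∀ j, y j ∈ Y j) ∧ v = ∑ j, y j}

/-- The expected dimension of a join. -/
noncomputable def expectedDim {r : ℕ} (Y : Fin r → Set V) : WithBot ℕ∞ :=
  min (∑ j, varietyDim (Y j)) (Module.finrank ℂ V : WithBot ℕ∞)

/-- The join of `Y_1, …, Y_r` is defective if its dimension is smaller than expected. -/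
def IsDefectiveJoin {r : ℕ} (Y : Fin r → Set V) : Prop :=
  varietyDim (varietyJoin Y) < expectedDim Y

/-- `X`, possibly reducible, is `r`-nondefective: no join of `r` irreducible components of
`X` (repetitions allowed) is defective. -/
def IsNondefective (X : Set V) (r : ℕ) : Prop :=
  ∀ Y : Fin r → Set V, (∀ j, IsComponentOf (Y j) X) → ¬ IsDefectiveJoin Y

end AffineVarieties

section PartitionRank

/-- The space `(ℂ^n)^{⊗ d}`. -/
abbrev Tensors (n d : ℕ) : Type := ⨂[ℂ]^d (Fin n → ℂ)

/-- The set `P_{k,σ}` of all tensors `t_{σ(1)} ⊗ … ⊗ t_{σ(l)}` of order `d`, where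
`t_i ∈ (ℂ^n)^{⊗ k_i}`. The product is the concatenation product of tensor powers of `ℂ^n`;
the equation in the graded monoid forces `d` to be the sum of the `k_i`. -/
def partitionComponent (n d : ℕ) {l : ℕ} (k : Fin l → ℕ) (σ : Equiv.Perm (Fin l)) :
    Set (Tensors n d) :=
  {T | ∃ t : ∀ i : Fin l, Tensors n (k i),
    (GradedMonoid.mk d T : GradedMonoid (Tensors n)) =
      (List.ofFn fun j : Fin l =>
        (GradedMonoid.mk (k (σ j)) (t (σ j)) : GradedMonoid (Tensors n))).prod}

/-- The partition-rank-one variety of `k`: the union of the `P_{k,σ}`. -/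
def partitionRankOne (n d : ℕ) {l : ℕ} (k : Fin l → ℕ) : Set (Tensors n d) :=
  ⋃ σ : Equiv.Perm (Fin l), partitionComponent n d k σ

/-- The tensor `T` has `k`-partition rank `r`: `r` is the least number of elements of the
partition-rank-one variety with sum `T`. -/
def HasPartitionRank {n d l : ℕ} (k : Fin l → ℕ) (T : Tensors n d) (r : ℕ) : Prop :=
  IsLeast {s : ℕ | ∃ t : Fin s → Tensors n d,
    (∀ j, t j ∈ partitionRankOne n d k) ∧ T = ∑ j, t j} r

/-- `r` is the generic `k`-partition rank of `(ℂ^n)^{⊗ d}`: all tensors in some nonempty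
(hence dense) Zariski open subset have `k`-partition rank `r`. -/
def IsGenericPartitionRank (n d : ℕ) {l : ℕ} (k : Fin l → ℕ) (r : ℕ) : Prop :=
  ∃ U : Set (Tensors n d), IsOpen[zariskiTopology (Tensors n d)] U ∧ U.Nonempty ∧
    ∀ T ∈ U, HasPartitionRank k T r

end PartitionRank

/-! In coordinates each `P_{k,σ}` is the image of a product map whose derivative at a general point
has rank `c`. By Terracini's principle, sums of such products are governed by the sum of their
tangent spaces at general points: `genericDim_le_varietyDim` bounds the dimension of a join from
below, and `zariskiClosure_range_blockSum` gives density. Both claims thus reduce to `genericDim s`,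
the generic dimension of the tangent sum for a list `s` of permutations.

Suppose a new point of type `a` gains less than `c` over `s`, so that its general tangent space `T`
meets the tangent sum `W` nontrivially. By `genericDim_submodular` the gain never grows as points
are added. If a further point of some type `s i` lowers it strictly, add that point. Otherwise the
points behind `W` can be exchanged for new ones one at a time without changing `T ⊓ W`
(`inf_tangentSum_hybrid_eq`), so a nonzero vector lies in every tangent sum of generic dimension.
The intersection of these sums is stable under the elementary automorphisms of each tensor slot
(`isSymmetry_slotEquiv`), and no proper nonzero subspace is (`eq_top_of_slotEquiv_mem`); hence `W`
is everything (`IsIrreducibleFamily.genericDim_eq`). As the gain starts below `c`, at most `c` extra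
points fill the space (`IsIrreducibleFamily.exists_genericDim_eq`).

A defect right after `m` points therefore forces `n^d ≤ c(m + c)`, which gives nondefectivity for
small `r`. At the first defect along a constant list one has `c m ≤ n^d`, so at most `n^d/c + c`
points fill the space. Chevalley's theorem (`IsPolynomialMap.isGeneric_range`) turns density into a
nonempty open set of sums. -/

/-! ### Polynomial functions, polynomial maps and generic sets. -/

section PolynomialFunctions

variable {P Q V : Type*} [AddCommGroup P] [Module ℂ P] [AddCommGroup Q] [Module ℂ Q]
  [AddCommGroup V] [Module ℂ V]

/-- A map between vector spaces whose coordinates are polynomial functions. -/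
def IsPolynomialMap (Φ : P → V) : Prop :=
  ∀ φ : Module.Dual ℂ V, (fun p => φ (Φ p)) ∈ polynomialFunctionAlgebra P

theorem dual_mem_polynomialFunctionAlgebra (φ : Module.Dual ℂ V) :
    (fun v => φ v) ∈ polynomialFunctionAlgebra V :=
  Algebra.subset_adjoin ⟨φ, rfl⟩

theorem const_mem_polynomialFunctionAlgebra (z : ℂ) :
    (fun _ => z) ∈ polynomialFunctionAlgebra V :=
  (polynomialFunctionAlgebra V).algebraMap_mem z

theorem IsPolynomialMap.comp_mem {Φ : P → V} (hΦ : IsPolynomialMap Φ) {f : V → ℂ}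
    (hf : f ∈ polynomialFunctionAlgebra V) :
    (fun p => f (Φ p)) ∈ polynomialFunctionAlgebra P := by
  induction hf using Algebra.adjoin_induction with
  | mem x hx => obtain ⟨φ, rfl⟩ := hx; exact hΦ φ
  | algebraMap z => exact const_mem_polynomialFunctionAlgebra z
  | add x y _ _ h1 h2 => exact add_mem h1 h2
  | mul x y _ _ h1 h2 => exact mul_mem h1 h2

theorem IsPolynomialMap.comp {Φ : P → V} {Ψ : Q → P} (hΦ : IsPolynomialMap Φ)
    (hΨ : IsPolynomialMap Ψ) : IsPolynomialMap (fun q => Φ (Ψ q)) :=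
  fun φ => hΨ.comp_mem (hΦ φ)

theorem LinearMap.isPolynomialMap (f : P →ₗ[ℂ] V) : IsPolynomialMap f :=
  fun φ => dual_mem_polynomialFunctionAlgebra (φ ∘ₗ f)

theorem isPolynomialMap_const (v : V) : IsPolynomialMap (fun _ : P => v) :=
  fun φ => const_mem_polynomialFunctionAlgebra (φ v)

theorem IsPolynomialMap.add {Φ Ψ : P → V} (hΦ : IsPolynomialMap Φ) (hΨ : IsPolynomialMap Ψ) :
    IsPolynomialMap (fun p => Φ p + Ψ p) := by
  intro φ
  simp only [map_add]
  exact add_mem (hΦ φ) (hΨ φ)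

theorem IsPolynomialMap.sum {ι : Type*} (s : Finset ι) {Φ : ι → P → V}
    (hΦ : ∀ i ∈ s, IsPolynomialMap (Φ i)) : IsPolynomialMap (fun p => ∑ i ∈ s, Φ i p) := by
  intro φ
  have := sum_mem (S := polynomialFunctionAlgebra P) fun i hi => hΦ i hi φ
  convert this using 1
  ext p
  simp

theorem isPolynomialMap_pi {κ : Type*} [Finite κ] {X : κ → Type*}
    [∀ j, AddCommGroup (X j)] [∀ j, Module ℂ (X j)] {Φ : P → ∀ j, X j}
    (hΦ : ∀ j, IsPolynomialMap (fun p => Φ p j)) : IsPolynomialMap Φ := by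
  classical
  have := Fintype.ofFinite κ
  intro φ
  have := sum_mem (S := polynomialFunctionAlgebra P) (t := Finset.univ) fun j _ =>
    hΦ j (φ ∘ₗ LinearMap.single ℂ X j)
  convert this using 1
  ext p
  rw [Finset.sum_apply]
  simp only [LinearMap.comp_apply, ← map_sum]
  congr 1
  exact (Finset.univ_sum_single (Φ p)).symm

theorem exists_polynomial_of_mem {f : ℂ → ℂ} (hf : f ∈ polynomialFunctionAlgebra ℂ) :
    ∃ p : Polynomial ℂ, ∀ z, f z = p.eval z := by
  induction hf using Algebra.adjoin_induction with
  | mem x hx =>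
    obtain ⟨φ, rfl⟩ := hx
    refine ⟨Polynomial.C (φ 1) * Polynomial.X, fun z => ?_⟩
    have : φ z = z • φ 1 := by rw [← map_smul]; simp
    show φ z = _
    rw [this, Polynomial.eval_C_mul, Polynomial.eval_X, smul_eq_mul, mul_comm]
  | algebraMap z => exact ⟨Polynomial.C z, fun _ => by simp⟩
  | add x y _ _ h1 h2 =>
    obtain ⟨p, hp⟩ := h1
    obtain ⟨q, hq⟩ := h2
    exact ⟨p + q, fun z => by simp [hp, hq]⟩
  | mul x y _ _ h1 h2 =>
    obtain ⟨p, hp⟩ := h1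
    obtain ⟨q, hq⟩ := h2
    exact ⟨p * q, fun z => by simp [hp, hq]⟩

/-- On the line through `v` and `w` both functions become nonzero polynomials in one variable, and
so does their product. This is the irreducibility of a vector space. -/
theorem exists_mul_apply_ne_zero {f g : V → ℂ} (hf : f ∈ polynomialFunctionAlgebra V)
    (hg : g ∈ polynomialFunctionAlgebra V) {v w : V} (hv : f v ≠ 0) (hw : g w ≠ 0) :
    ∃ u, f u ≠ 0 ∧ g u ≠ 0 := by
  have hl : IsPolynomialMap (fun z : ℂ => v + z • (w - v)) :=
    (isPolynomialMap_const v).add (LinearMap.toSpanSingleton ℂ V (w - v)).isPolynomialMap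
  obtain ⟨p, hp⟩ := exists_polynomial_of_mem (hl.comp_mem hf)
  obtain ⟨q, hq⟩ := exists_polynomial_of_mem (hl.comp_mem hg)
  have hp0 : p ≠ 0 := by
    rintro rfl
    apply hv
    simpa using hp 0
  have hq0 : q ≠ 0 := by
    rintro rfl
    apply hw
    simpa using hq 1
  obtain ⟨z, hz⟩ : ∃ z, (p * q).eval z ≠ 0 := by
    by_contra! h
    exact mul_ne_zero hp0 hq0 (Polynomial.funext (by simpa using h))
  refine ⟨v + z • (w - v), ?_, ?_⟩
  · rw [hp z]
    exact fun h => hz (by simp [h])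
  · rw [hq z]
    exact fun h => hz (by simp [h])

instance : IsDomain (polynomialFunctionAlgebra V) := by
  have : NoZeroDivisors (polynomialFunctionAlgebra V) := by
    refine ⟨fun {f g} h => ?_⟩
    by_contra! hfg
    obtain ⟨hf, hg⟩ := hfg
    have hf' : ∃ v, f.1 v ≠ 0 := by
      by_contra! h0
      exact hf (Subtype.ext (funext h0))
    have hg' : ∃ v, g.1 v ≠ 0 := by
      by_contra! h0
      exact hg (Subtype.ext (funext h0))
    obtain ⟨v, hv⟩ := hf'
    obtain ⟨w, hw⟩ := hg'
    obtain ⟨u, h1, h2⟩ := exists_mul_apply_ne_zero f.2 g.2 hv hw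
    have := congrFun (congrArg Subtype.val h) u
    simp at this
    tauto
  exact NoZeroDivisors.to_isDomain _

/-- A set containing the nonvanishing locus of a nonzero polynomial function. -/
def IsGeneric (A : Set V) : Prop :=
  ∃ f ∈ polynomialFunctionAlgebra V, (∃ v, f v ≠ 0) ∧ ∀ v, f v ≠ 0 → v ∈ A

theorem IsGeneric.mono {A B : Set V} (hA : IsGeneric A) (h : A ⊆ B) : IsGeneric B := by
  obtain ⟨f, hf, h1, h2⟩ := hA
  exact ⟨f, hf, h1, fun v hv => h (h2 v hv)⟩

theorem IsGeneric.inter {A B : Set V} (hA : IsGeneric A) (hB : IsGeneric B) :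
    IsGeneric (A ∩ B) := by
  obtain ⟨f, hf, ⟨v, hv⟩, h2⟩ := hA
  obtain ⟨g, hg, ⟨w, hw⟩, h4⟩ := hB
  obtain ⟨u, h5, h6⟩ := exists_mul_apply_ne_zero hf hg hv hw
  exact ⟨f * g, mul_mem hf hg, ⟨u, mul_ne_zero h5 h6⟩, fun x hx =>
    ⟨h2 x (left_ne_zero_of_mul hx), h4 x (right_ne_zero_of_mul hx)⟩⟩

theorem IsGeneric.univ : IsGeneric (Set.univ : Set V) :=
  ⟨fun _ => 1, const_mem_polynomialFunctionAlgebra 1, ⟨0, one_ne_zero⟩, fun _ _ => trivial⟩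

theorem IsGeneric.iInter {ι : Type*} [Finite ι] {A : ι → Set V} (hA : ∀ i, IsGeneric (A i)) :
    IsGeneric (⋂ i, A i) := by
  classical
  have := Fintype.ofFinite ι
  have h : ∀ s : Finset ι, IsGeneric (⋂ i ∈ s, A i) := by
    intro s
    induction s using Finset.induction_on with
    | empty => simpa using IsGeneric.univ
    | insert a s _ ih =>
      rw [Finset.set_biInter_insert]
      exact (hA a).inter ih
  simpa using h Finset.univ

theorem IsGeneric.nonempty {A : Set V} (hA : IsGeneric A) : A.Nonempty := by
  obtain ⟨f, hf, ⟨v, hv⟩, h2⟩ := hA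
  exact ⟨v, h2 v hv⟩

theorem IsGeneric.preimage {A : Set V} (hA : IsGeneric A) {Φ : P → V}
    (hΦ : IsPolynomialMap Φ) (hs : Function.Surjective Φ) : IsGeneric (Φ ⁻¹' A) := by
  obtain ⟨f, hf, ⟨v, hv⟩, h2⟩ := hA
  obtain ⟨p, rfl⟩ := hs v
  exact ⟨_, hΦ.comp_mem hf, ⟨p, hv⟩, fun q hq => h2 _ hq⟩

open Module in
/-- In a polynomial family of linear maps the rank is generically at least the rank of any
given member. -/
theorem isGeneric_finrank_range_ge {A B : Type*} [AddCommGroup A] [Module ℂ A]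
    [AddCommGroup B] [Module ℂ B] [FiniteDimensional ℂ B] (L : P → A →ₗ[ℂ] B)
    (hL : ∀ u, IsPolynomialMap (fun p => L p u)) (p₀ : P) :
    ∃ f ∈ polynomialFunctionAlgebra P, f p₀ ≠ 0 ∧ ∀ p, f p ≠ 0 →
      finrank ℂ (LinearMap.range (L p₀)) ≤ finrank ℂ (LinearMap.range (L p)) := by
  classical
  set r := finrank ℂ (LinearMap.range (L p₀)) with hr
  let b := Module.finBasis ℂ (LinearMap.range (L p₀))
  choose u hu using fun i => (b i).2
  have hli : LinearIndependent ℂ (fun i => L p₀ (u i)) := by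
    have : (fun i => L p₀ (u i)) = (LinearMap.range (L p₀)).subtype ∘ b := funext hu
    rw [this]
    exact b.linearIndependent.map' _ (Submodule.ker_subtype _)
  obtain ⟨g, hg⟩ := (Fintype.linearCombination ℂ (fun i => L p₀ (u i))).exists_leftInverse_of_injective
    (by rw [LinearMap.ker_eq_bot]; exact linearIndependent_iff_injective_fintypeLinearCombination.1 hli)
  have hgi : ∀ i, g (L p₀ (u i)) = Pi.single i 1 := by
    intro i
    have := LinearMap.congr_fun hg (Pi.single i 1)
    simpa [Fintype.linearCombination_apply_single] using this
  -- The left inverse `g` reads off an `r × r` minor that is the identity at `p₀`; its determinant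
  -- is the required function.
  let M : P → Matrix (Fin r) (Fin r) ℂ := fun p => Matrix.of fun i j => g (L p (u i)) j
  have hM0 : M p₀ = 1 := by
    ext i j
    simp [M, hgi, Matrix.one_apply, Pi.single_apply, eq_comm]
  refine ⟨fun p => (M p).det, ?_, by simp [hM0], fun p hp => ?_⟩
  · have : (fun p => (M p).det) = ∑ σ : Equiv.Perm (Fin r), (fun _ => ((Equiv.Perm.sign σ : ℤ) : ℂ)) *
        ∏ i, (fun p => M p (σ i) i) := by
      ext p
      rw [Matrix.det_apply']
      simp
    rw [this]
    refine sum_mem fun σ _ => mul_mem (const_mem_polynomialFunctionAlgebra _)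
      (prod_mem fun i _ => ?_)
    exact hL (u (σ i)) (LinearMap.proj i ∘ₗ g)
  · have hli : LinearIndependent ℂ (fun i => (⟨L p (u i), ⟨_, rfl⟩⟩ : LinearMap.range (L p))) := by
      rw [Fintype.linearIndependent_iff]
      intro a ha
      have h1 : ∑ i, a i • L p (u i) = 0 := by simpa using congrArg Subtype.val ha
      have h2 : Matrix.vecMul a (M p) = 0 := by
        ext j
        have := congrFun (congrArg g h1) j
        simpa [Matrix.vecMul, dotProduct, M] using this
      have := Matrix.eq_zero_of_vecMul_eq_zero hp h2
      exact fun i => congrFun this i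
    simpa using hli.fintype_card_le_finrank

end PolynomialFunctions

/-! ### Zariski closure, irreducibility and density. -/

section Zariski

variable {P V : Type*} [AddCommGroup P] [Module ℂ P] [AddCommGroup V] [Module ℂ V]

theorem isTopologicalBasis_zariski :
    @TopologicalSpace.IsTopologicalBasis V (zariskiTopology V)
      {U | ∃ f ∈ polynomialFunctionAlgebra V, U = {v | f v ≠ 0}} := by
  let := zariskiTopology V
  refine ⟨?_, ?_, rfl⟩
  · rintro _ ⟨f, hf, rfl⟩ _ ⟨g, hg, rfl⟩ x ⟨h1, h2⟩
    exact ⟨_, ⟨f * g, mul_mem hf hg, rfl⟩, mul_ne_zero h1 h2, fun y hy =>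
      ⟨left_ne_zero_of_mul hy, right_ne_zero_of_mul hy⟩⟩
  · refine Set.eq_univ_of_forall fun v => ⟨_, ⟨fun _ => 1, const_mem_polynomialFunctionAlgebra 1, rfl⟩, ?_⟩
    simp

theorem isOpen_zariski_ne_zero {f : V → ℂ} (hf : f ∈ polynomialFunctionAlgebra V) :
    IsOpen[zariskiTopology V] {v | f v ≠ 0} :=
  TopologicalSpace.isOpen_generateFrom_of_mem ⟨f, hf, rfl⟩

theorem mem_zariskiClosure_iff {Z : Set V} {v : V} :
    v ∈ zariskiClosure Z ↔
      ∀ f ∈ polynomialFunctionAlgebra V, (∀ z ∈ Z, f z = 0) → f v = 0 := by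
  let := zariskiTopology V
  rw [zariskiClosure, (isTopologicalBasis_zariski (V := V)).mem_closure_iff]
  constructor
  · intro h f hf hz
    by_contra hv
    obtain ⟨z, h1, h2⟩ := h _ ⟨f, hf, rfl⟩ hv
    exact h1 (hz z h2)
  · rintro h _ ⟨f, hf, rfl⟩ hv
    by_contra hne
    refine hv (h f hf fun z hz => ?_)
    by_contra h0
    exact hne ⟨z, h0, hz⟩

theorem subset_zariskiClosure (Z : Set V) : Z ⊆ zariskiClosure Z :=
  @subset_closure V (zariskiTopology V) Z

theorem IsPolynomialMap.isIrreducible_range {Φ : P → V} (hΦ : IsPolynomialMap Φ) :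
    @IsIrreducible V (zariskiTopology V) (Set.range Φ) := by
  let := zariskiTopology V
  refine ⟨⟨Φ 0, 0, rfl⟩, ?_⟩
  rintro u v hu hv ⟨_, ⟨p, rfl⟩, hp⟩ ⟨_, ⟨q, rfl⟩, hq⟩
  obtain ⟨_, ⟨f, hf, rfl⟩, hfp, hfu⟩ :=
    (isTopologicalBasis_zariski (V := V)).exists_subset_of_mem_open hp hu
  obtain ⟨_, ⟨g, hg, rfl⟩, hgq, hgv⟩ :=
    (isTopologicalBasis_zariski (V := V)).exists_subset_of_mem_open hq hv
  obtain ⟨x, h1, h2⟩ := exists_mul_apply_ne_zero (hΦ.comp_mem hf) (hΦ.comp_mem hg) hfp hgq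
  exact ⟨Φ x, ⟨x, rfl⟩, hfu h1, hgv h2⟩

theorem isGeneric_compl_zariskiClosure {Z : Set V} (h : zariskiClosure Z ≠ Set.univ) :
    IsGeneric (zariskiClosure Z)ᶜ := by
  obtain ⟨v, hv⟩ := (Set.ne_univ_iff_exists_notMem _).1 h
  rw [mem_zariskiClosure_iff] at hv
  push Not at hv
  obtain ⟨f, hf, hz, hv⟩ := hv
  exact ⟨f, hf, ⟨v, hv⟩, fun w hw hmem => hw (mem_zariskiClosure_iff.1 hmem f hf hz)⟩

theorem isGeneric_compl_of_not_dense {Z : Set V} (h : zariskiClosure Z ≠ Set.univ) :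
    IsGeneric Zᶜ :=
  (isGeneric_compl_zariskiClosure h).mono (Set.compl_subset_compl.2 (subset_zariskiClosure Z))

/-- A finite union of sets that is Zariski dense has a dense member. -/
theorem exists_zariskiClosure_eq_univ {κ : Type*} [Finite κ] {Z : κ → Set V}
    (h : zariskiClosure (⋃ i, Z i) = Set.univ) : ∃ i, zariskiClosure (Z i) = Set.univ := by
  by_contra! hne
  have h1 := fun i => isGeneric_compl_zariskiClosure (hne i)
  obtain ⟨v, hv⟩ := (IsGeneric.iInter h1).nonempty
  have hv' : v ∈ zariskiClosure (⋃ i, Z i) := h ▸ Set.mem_univ v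
  let := zariskiTopology V
  rw [zariskiClosure, closure_iUnion_of_finite] at hv'
  obtain ⟨i, hi⟩ := Set.mem_iUnion.1 hv'
  exact Set.mem_iInter.1 hv i hi

end Zariski

/-! ### Krull dimension and transcendence degree. -/

section KrullDimension

open Algebra

/-- Incomparability makes contraction of primes strictly monotone, which gives `≤`; lying over and
going up lift chains, which gives `≥`. -/
theorem ringKrullDim_eq_of_isIntegral_of_injective {R S : Type*} [CommRing R] [CommRing S]
    [Algebra R S] [Algebra.IsIntegral R S] (h : Function.Injective (algebraMap R S)) :
    ringKrullDim S = ringKrullDim R := by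
  apply le_antisymm
  · exact Order.krullDim_le_of_strictMono (PrimeSpectrum.comap (algebraMap R S)) fun I J hIJ =>
      Ideal.IsIntegral.comap_lt_comap (R := R) (I := I.asIdeal) (J := J.asIdeal) hIJ
  · refine iSup_le fun L => ?_
    obtain ⟨Q, -, hQ, hQL⟩ := Ideal.exists_ideal_over_prime_of_isIntegral (S := S) L.head.asIdeal ⊥
      (by
        rw [← RingHom.ker_eq_comap_bot, (RingHom.injective_iff_ker_eq_bot _).1 h]
        exact bot_le)
    have : Q.LiesOver L.head.asIdeal := ⟨hQL.symm⟩
    obtain ⟨L', hlen, -⟩ := Ideal.exists_ltSeries_of_hasGoingUp (S := S) L Q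
    rw [← hlen]
    exact le_iSup (fun p : LTSeries (PrimeSpectrum S) => (p.length : WithBot ℕ∞)) L'

universe u

/-- Noether normalisation: `A` is integral over a polynomial ring in `s` variables, and both
invariants are unchanged by the integral extension. -/
theorem exists_ringKrullDim_eq_trdeg (k A : Type u) [Field k] [CommRing A] [IsDomain A]
    [Algebra k A] [Algebra.FiniteType k A] :
    ∃ s : ℕ, ringKrullDim A = s ∧ Algebra.trdeg k A = s := by
  obtain ⟨s, g, hinj, hint⟩ := exists_integral_inj_algHom_of_fg k A
  let := g.toRingHom.toAlgebra
  have : Algebra.IsIntegral (MvPolynomial (Fin s) k) A := ⟨hint⟩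
  have : IsScalarTower k (MvPolynomial (Fin s) k) A :=
    IsScalarTower.of_algebraMap_eq fun x => (g.commutes x).symm
  have : FaithfulSMul (MvPolynomial (Fin s) k) A :=
    (faithfulSMul_iff_algebraMap_injective _ _).2 hinj
  refine ⟨s, ?_, ?_⟩
  · rw [ringKrullDim_eq_of_isIntegral_of_injective (R := MvPolynomial (Fin s) k) hinj]
    simp
  · rw [← trdeg_add_eq k (MvPolynomial (Fin s) k) (A := A),
      trdeg_eq_zero (R := MvPolynomial (Fin s) k)]
    simp

theorem le_ringKrullDim_of_algebraicIndependent {k A : Type u} [Field k] [CommRing A] [IsDomain A]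
    [Algebra k A] [Algebra.FiniteType k A] {r : ℕ} {x : Fin r → A}
    (hx : AlgebraicIndependent k x) : (r : WithBot ℕ∞) ≤ ringKrullDim A := by
  obtain ⟨s, h1, h2⟩ := exists_ringKrullDim_eq_trdeg k A
  have := hx.lift_cardinalMk_le_trdeg
  rw [h2] at this
  have h3 : r ≤ s := by simpa using this
  rw [h1]
  exact_mod_cast h3

theorem ringKrullDim_le_of_injective {k A B : Type u} [Field k] [CommRing A] [IsDomain A]
    [Algebra k A] [Algebra.FiniteType k A] [CommRing B] [IsDomain B] [Algebra k B]
    (f : A →ₐ[k] B) (hf : Function.Injective f) {r : ℕ} (hr : Algebra.trdeg k B ≤ r) :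
    ringKrullDim A ≤ r := by
  obtain ⟨s, h1, h2⟩ := exists_ringKrullDim_eq_trdeg k A
  have := (trdeg_le_of_injective f hf).trans hr
  rw [h2] at this
  have h3 : s ≤ r := by exact_mod_cast this
  rw [h1]
  exact_mod_cast h3

/-- A subalgebra generated by the image of a finite-dimensional space is generated by the images
of the basis vectors. -/
theorem adjoin_range_eq_adjoin_range_finBasis {k E A : Type*} [Field k] [AddCommGroup E] [Module k E]
    [FiniteDimensional k E] [CommRing A] [Algebra k A] (ρ : E →ₗ[k] A) :
    Algebra.adjoin k (Set.range ρ) =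
      Algebra.adjoin k (Set.range fun i => ρ (Module.finBasis k E i)) := by
  apply le_antisymm
  · refine Algebra.adjoin_le ?_
    rintro _ ⟨e, rfl⟩
    rw [← (Module.finBasis k E).sum_repr e, map_sum]
    refine sum_mem fun i _ => ?_
    rw [map_smul]
    exact Subalgebra.smul_mem _ (Algebra.subset_adjoin (Set.mem_range_self i)) _
  · exact Algebra.adjoin_mono (Set.range_comp_subset_range _ ρ)

end KrullDimension

/-! ### Bounding the dimension of a set through a parametrization. -/

section Dimension

variable {P V : Type} [AddCommGroup P] [Module ℂ P] [AddCommGroup V] [Module ℂ V]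

/-- Restriction of linear functionals to a subset. -/
def restrictDual (Z : Set V) : Module.Dual ℂ V →ₗ[ℂ] (Z → ℂ) where
  toFun φ z := φ z
  map_add' _ _ := rfl
  map_smul' _ _ := rfl

instance [FiniteDimensional ℂ V] (Z : Set V) : Algebra.FiniteType ℂ (coordinateRing Z) := by
  rw [← Subalgebra.fg_iff_finiteType]
  have : coordinateRing Z = Algebra.adjoin ℂ (Set.range (restrictDual Z)) := rfl
  rw [this, adjoin_range_eq_adjoin_range_finBasis]
  exact Subalgebra.fg_def.2 ⟨_, Set.finite_range _, rfl⟩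

/-- Every polynomial function is a polynomial in the coordinates. -/
theorem polynomialFunctionAlgebra_eq_range [FiniteDimensional ℂ V] :
    polynomialFunctionAlgebra V = (MvPolynomial.aeval (R := ℂ) fun i =>
      (fun v => Module.finBasis ℂ (Module.Dual ℂ V) i v : V → ℂ)).range := by
  rw [← Algebra.adjoin_range_eq_range_aeval]
  exact adjoin_range_eq_adjoin_range_finBasis
    (⟨⟨fun φ v => φ v, fun _ _ => rfl⟩, fun _ _ => rfl⟩ : Module.Dual ℂ V →ₗ[ℂ] (V → ℂ))

theorem trdeg_polynomialFunctionAlgebra_le [FiniteDimensional ℂ V] :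
    Algebra.trdeg ℂ (polynomialFunctionAlgebra V) ≤ Module.finrank ℂ V := by
  rw [polynomialFunctionAlgebra_eq_range]
  refine (trdeg_le_of_surjective _ (AlgHom.rangeRestrict_surjective _)).trans ?_
  simp

/-- Restriction of functions to a subset. -/
def restrictFun (Z : Set V) : (V → ℂ) →ₐ[ℂ] (Z → ℂ) where
  toFun f z := f z
  map_one' := rfl
  map_mul' _ _ := rfl
  map_zero' := rfl
  map_add' _ _ := rfl
  commutes' _ := rfl

theorem coordinateRing_eq_map (Z : Set V) :
    coordinateRing Z = (polynomialFunctionAlgebra V).map (restrictFun Z) := by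
  rw [coordinateRing, polynomialFunctionAlgebra, AlgHom.map_adjoin, ← Set.range_comp]
  rfl

/-- Pullback of functions along a map into `Z`. -/
def pullbackFun {Z : Set V} (Φ : P → Z) : (Z → ℂ) →ₐ[ℂ] (P → ℂ) where
  toFun f p := f (Φ p)
  map_one' := rfl
  map_mul' _ _ := rfl
  map_zero' := rfl
  map_add' _ _ := rfl
  commutes' _ := rfl

theorem IsPolynomialMap.pullbackFun_mem {Φ : P → V} (hΦ : IsPolynomialMap Φ) {Z : Set V}
    (h : ∀ p, Φ p ∈ Z) {f : Z → ℂ} (hf : f ∈ coordinateRing Z) :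
    pullbackFun (fun p => ⟨Φ p, h p⟩) f ∈ polynomialFunctionAlgebra P := by
  rw [coordinateRing_eq_map] at hf
  obtain ⟨F, hF, rfl⟩ := hf
  exact hΦ.comp_mem hF

/-- A function vanishing on the image of `Φ` vanishes on `Z`, so pullback embeds the coordinate ring
into the polynomial functions on `P`, whose transcendence degree is at most `dim P`. -/
theorem varietyDim_le_of_subset_zariskiClosure_range [FiniteDimensional ℂ P] [FiniteDimensional ℂ V]
    {Φ : P → V} (hΦ : IsPolynomialMap Φ) {Z : Set V} (h1 : ∀ p, Φ p ∈ Z)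
    (h2 : Z ⊆ zariskiClosure (Set.range Φ)) : varietyDim Z ≤ Module.finrank ℂ P := by
  let f : coordinateRing Z →ₐ[ℂ] polynomialFunctionAlgebra P :=
    ((pullbackFun (fun p => (⟨Φ p, h1 p⟩ : Z))).comp (coordinateRing Z).val).codRestrict _
      fun x => hΦ.pullbackFun_mem h1 x.2
  have hf : Function.Injective f := by
    rw [injective_iff_map_eq_zero]
    rintro ⟨x, hx⟩ h0
    rw [coordinateRing_eq_map] at hx
    obtain ⟨F, hF, rfl⟩ := hx
    refine Subtype.ext (funext fun z => ?_)
    refine mem_zariskiClosure_iff.1 (h2 z.2) F hF ?_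
    rintro _ ⟨p, rfl⟩
    exact congrFun (congrArg Subtype.val h0) p
  have : IsDomain (coordinateRing Z) := hf.isDomain f.toRingHom
  exact ringKrullDim_le_of_injective f hf trdeg_polynomialFunctionAlgebra_le

/-- `Z` may be reducible, so its coordinate ring is first replaced by its image in the functions on
`P`. That quotient is a domain of no larger Krull dimension, and the forms `ℓ i` stay algebraically
independent in it. -/
theorem le_varietyDim_of_forall_eval_eq_zero [FiniteDimensional ℂ V]
    {Φ : P → V} (hΦ : IsPolynomialMap Φ) {Z : Set V} (h1 : ∀ p, Φ p ∈ Z) {r : ℕ}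
    (ℓ : Fin r → Module.Dual ℂ V)
    (hℓ : ∀ Q : MvPolynomial (Fin r) ℂ,
      (∀ p, MvPolynomial.eval (fun i => ℓ i (Φ p)) Q = 0) → Q = 0) :
    r ≤ varietyDim Z := by
  let f : coordinateRing Z →ₐ[ℂ] polynomialFunctionAlgebra P :=
    ((pullbackFun (fun p => (⟨Φ p, h1 p⟩ : Z))).comp (coordinateRing Z).val).codRestrict _
      fun x => hΦ.pullbackFun_mem h1 x.2
  have hsurj := f.rangeRestrict_surjective
  have : Algebra.FiniteType ℂ f.range := Algebra.FiniteType.of_surjective f.rangeRestrict hsurj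
  refine le_trans ?_ (ringKrullDim_le_of_surjective f.rangeRestrict.toRingHom hsurj)
  let y : Fin r → coordinateRing Z := fun i =>
    ⟨fun z => ℓ i z, Algebra.subset_adjoin ⟨ℓ i, rfl⟩⟩
  refine le_ringKrullDim_of_algebraicIndependent (k := ℂ) (x := fun i => f.rangeRestrict (y i)) ?_
  rw [AlgebraicIndependent, injective_iff_map_eq_zero]
  intro Q hQ
  refine hℓ Q fun p => ?_
  let e : f.range →ₐ[ℂ] ℂ :=
    ((Pi.evalAlgHom ℂ (fun _ : P => ℂ) p).comp (polynomialFunctionAlgebra P).val).comp f.range.val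
  have h3 : e (MvPolynomial.aeval (fun i => f.rangeRestrict (y i)) Q) = 0 := by rw [hQ, map_zero]
  rw [MvPolynomial.comp_aeval_apply] at h3
  exact h3

end Dimension

/-! ### Polynomials vanishing on the image of a submersion. -/

section Submersion

/-- A polynomial vanishing on the image of a map that is a submersion at some point is zero. -/
theorem MvPolynomial.eq_zero_of_hasStrictFDerivAt {E : Type*} [NormedAddCommGroup E]
    [NormedSpace ℂ E] [CompleteSpace E] {r : ℕ} {g : E → Fin r → ℂ} {g' : E →L[ℂ] (Fin r → ℂ)}
    {p : E} (hg : HasStrictFDerivAt g g' p) (hs : g'.range = ⊤) {Q : MvPolynomial (Fin r) ℂ}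
    (hQ : ∀ q, MvPolynomial.eval (g q) Q = 0) : Q = 0 := by
  -- A strictly differentiable map with surjective derivative is locally open, so the image contains
  -- a box with infinite sides, on which only the zero polynomial vanishes.
  have h1 : Set.range g ∈ 𝓝 (g p) := by
    rw [← hg.map_nhds_eq_of_surj hs]
    exact Filter.range_mem_map
  rw [nhds_pi, Filter.mem_pi'] at h1
  obtain ⟨I, t, ht, hsub⟩ := h1
  refine MvPolynomial.funext_set t (fun i => infinite_of_mem_nhds _ (ht i)) fun x hx => ?_
  obtain ⟨q, rfl⟩ := hsub fun i _ => hx i trivial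
  rw [hQ, map_zero]

end Submersion

/-! ### Chevalley's theorem and the Nullstellensatz for polynomial maps. -/

section Chevalley

/-- **Chevalley's theorem** for domains: the image of a dominant morphism of finite presentation
contains a nonempty basic open set. -/
theorem exists_basicOpen_subset_range_comap {A B : Type*} [CommRing A] [IsDomain A] [CommRing B]
    [IsDomain B] {f : A →+* B} (hf : f.FinitePresentation) (hinj : Function.Injective f) :
    ∃ h : A, h ≠ 0 ∧
      ∀ p : PrimeSpectrum A, h ∉ p.asIdeal → p ∈ Set.range (PrimeSpectrum.comap f) := by
  obtain ⟨S, hS⟩ := PrimeSpectrum.exists_constructibleSetData_iff.mpr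
    (PrimeSpectrum.isConstructible_range_comap hf)
  -- The generic point lies in the image by injectivity, hence in one locally closed piece. The
  -- equations of that piece vanish at the generic point, so they are zero and the piece is a basic
  -- open set.
  have h0 : (⊥ : PrimeSpectrum A) ∈ S.toSet := by
    rw [hS]
    refine ⟨⊥, ?_⟩
    ext x
    simp [map_eq_zero_iff f hinj]
  rw [PrimeSpectrum.ConstructibleSetData.toSet, Set.mem_iUnion₂] at h0
  obtain ⟨C, hC, h1, h2⟩ := h0
  refine ⟨C.f, fun h => h2 ?_, fun p hp => ?_⟩
  · rintro _ rfl
    simp [h]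
  · rw [← hS, PrimeSpectrum.ConstructibleSetData.toSet, Set.mem_iUnion₂]
    refine ⟨C, hC, fun x hx => ?_, fun h => hp (h rfl)⟩
    have : x = 0 := h1 hx
    simp [this]

variable {P V : Type} [AddCommGroup P] [Module ℂ P] [AddCommGroup V] [Module ℂ V]
  [FiniteDimensional ℂ P] [FiniteDimensional ℂ V]

instance : Algebra.FiniteType ℂ (polynomialFunctionAlgebra V) := by
  rw [polynomialFunctionAlgebra_eq_range]
  exact Algebra.FiniteType.of_surjective _ (AlgHom.rangeRestrict_surjective _)

/-- The value of a polynomial function at a point, as an algebra homomorphism. -/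
def polynomialFunctionEval (v : V) : polynomialFunctionAlgebra V →ₐ[ℂ] ℂ :=
  (Pi.evalAlgHom ℂ (fun _ : V => ℂ) v).comp (polynomialFunctionAlgebra V).val

/-- On linear functionals a character is evaluation at a vector by biduality, and these functionals
generate the algebra. -/
theorem polynomialFunctionEval_surjective (χ : polynomialFunctionAlgebra V →ₐ[ℂ] ℂ) :
    ∃ v, χ = polynomialFunctionEval v := by
  let ρ : Module.Dual ℂ V →ₗ[ℂ] polynomialFunctionAlgebra V :=
    ⟨⟨fun φ => ⟨_, dual_mem_polynomialFunctionAlgebra φ⟩, fun _ _ => rfl⟩, fun _ _ => rfl⟩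
  obtain ⟨v, hv⟩ := (Module.evalEquiv ℂ V).surjective (χ.toLinearMap ∘ₗ ρ)
  refine ⟨v, AlgHom.ext ?_⟩
  rintro ⟨f, hf⟩
  induction hf using Algebra.adjoin_induction with
  | mem x hx =>
    obtain ⟨φ, rfl⟩ := hx
    exact (LinearMap.congr_fun hv φ).symm
  | algebraMap z => exact (χ.commutes z).trans ((polynomialFunctionEval v).commutes z).symm
  | add x y hx hy h1 h2 =>
    exact (map_add χ ⟨x, hx⟩ ⟨y, hy⟩).trans ((congrArg₂ _ h1 h2).trans
      (map_add (polynomialFunctionEval v) ⟨x, hx⟩ ⟨y, hy⟩).symm)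
  | mul x y hx hy h1 h2 =>
    exact (map_mul χ ⟨x, hx⟩ ⟨y, hy⟩).trans ((congrArg₂ _ h1 h2).trans
      (map_mul (polynomialFunctionEval v) ⟨x, hx⟩ ⟨y, hy⟩).symm)

/-- Zariski's lemma: `K` is finite over `k`, so it embeds into the algebraically closed field `k`.
-/
theorem nonempty_algHom_of_finiteType (k K : Type*) [Field k] [IsAlgClosed k] [Field K]
    [Algebra k K] [Algebra.FiniteType k K] : Nonempty (K →ₐ[k] k) := by
  have : Module.Finite k K := finite_of_finite_type_of_isJacobsonRing k K
  exact ⟨IsAlgClosed.lift⟩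

/-- The weak Nullstellensatz for the algebra of polynomial functions. -/
theorem exists_le_ker_polynomialFunctionEval {I : Ideal (polynomialFunctionAlgebra V)}
    (hI : I ≠ ⊤) : ∃ v, ∀ f ∈ I, f.1 v = 0 := by
  obtain ⟨M, hM, hIM⟩ := I.exists_le_maximal hI
  let : Field (polynomialFunctionAlgebra V ⧸ M) := Ideal.Quotient.field M
  obtain ⟨χ⟩ := nonempty_algHom_of_finiteType ℂ (polynomialFunctionAlgebra V ⧸ M)
  obtain ⟨v, hv⟩ := polynomialFunctionEval_surjective (χ.comp (Ideal.Quotient.mkₐ ℂ M))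
  refine ⟨v, fun f hf => ?_⟩
  have : polynomialFunctionEval v f = χ (Ideal.Quotient.mkₐ ℂ M f) := by rw [← hv]; rfl
  have h2 : Ideal.Quotient.mkₐ ℂ M f = 0 := Ideal.Quotient.eq_zero_iff_mem.2 (hIM hf)
  rw [h2, map_zero] at this
  exact this

/-- The image of a dominant polynomial map contains a nonempty Zariski open set. -/
theorem IsPolynomialMap.isGeneric_range {Φ : P → V} (hΦ : IsPolynomialMap Φ)
    (hd : zariskiClosure (Set.range Φ) = Set.univ) : IsGeneric (Set.range Φ) := by
  let θ : polynomialFunctionAlgebra V →ₐ[ℂ] polynomialFunctionAlgebra P :=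
    { toFun := fun f => ⟨fun p => f.1 (Φ p), hΦ.comp_mem f.2⟩
      map_one' := rfl
      map_mul' := fun _ _ => rfl
      map_zero' := rfl
      map_add' := fun _ _ => rfl
      commutes' := fun _ => rfl }
  have hinj : Function.Injective θ := by
    rw [injective_iff_map_eq_zero]
    rintro ⟨f, hf⟩ h
    refine Subtype.ext (funext fun v => ?_)
    have hv : v ∈ zariskiClosure (Set.range Φ) := hd ▸ Set.mem_univ v
    refine mem_zariskiClosure_iff.1 hv f hf ?_
    rintro _ ⟨p, rfl⟩
    exact congrFun (congrArg Subtype.val h) p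
  have : IsNoetherianRing (polynomialFunctionAlgebra V) :=
    Algebra.FiniteType.isNoetherianRing ℂ _
  have hfp : θ.toRingHom.FinitePresentation := by
    rw [← RingHom.FinitePresentation.of_finiteType]
    refine RingHom.FiniteType.of_comp_finiteType (f := algebraMap ℂ _) ?_
    have h1 : θ.toRingHom.comp (algebraMap ℂ _) = algebraMap ℂ (polynomialFunctionAlgebra P) :=
      θ.comp_algebraMap
    rw [h1, RingHom.finiteType_algebraMap]
    infer_instance
  obtain ⟨h, h0, hh⟩ := exists_basicOpen_subset_range_comap hfp hinj
  refine ⟨h.1, h.2, ?_, fun v hv => ?_⟩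
  · by_contra! hz
    exact h0 (Subtype.ext (funext hz))
  · have : (RingHom.ker (polynomialFunctionEval v)).IsPrime := RingHom.ker_isPrime _
    -- The prime `q` over the maximal ideal of `v` need not be maximal, so the Nullstellensatz
    -- supplies a point `p` where all of `q` vanishes. Pulling back the functions `φ - φ v` then
    -- forces `Φ p = v`.
    obtain ⟨q, hq⟩ := hh ⟨RingHom.ker (polynomialFunctionEval v), this⟩ hv
    obtain ⟨p, hp⟩ := exists_le_ker_polynomialFunctionEval q.2.ne_top
    refine ⟨p, ?_⟩
    rw [← sub_eq_zero, ← Module.forall_dual_apply_eq_zero_iff ℂ]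
    intro φ
    let x : polynomialFunctionAlgebra V := ⟨fun w => φ w - φ v,
      sub_mem (dual_mem_polynomialFunctionAlgebra φ) (const_mem_polynomialFunctionAlgebra _)⟩
    have hx : x ∈ (PrimeSpectrum.comap θ.toRingHom q).asIdeal := by
      rw [hq]
      exact sub_self (φ v)
    rw [map_sub]
    exact hp _ hx

end Chevalley

/-! ### Generic dimension of sums of tangent spaces, and the filling argument. -/

section TangentSums

open Module LinearMap

variable {S F V : Type} [AddCommGroup F] [Module ℂ F] [AddCommGroup V] [Module ℂ V]
variable (D : S → F → F →ₗ[ℂ] V)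

/-- The sum of the tangent spaces (images of the linear maps `D (s i) (q i)`) at a tuple of
points. -/
def tangentSum {ι : Type} (s : ι → S) (q : ι → F) : Submodule ℂ V :=
  ⨆ i, range (D (s i) (q i))

/-- The maximal, equivalently generic, dimension of a sum of tangent spaces. -/
noncomputable def genericDim {ι : Type} (s : ι → S) : ℕ :=
  ⨆ q : ι → F, finrank ℂ (tangentSum D s q)

/-- The linear map whose image is the sum of the tangent spaces. -/
def sumTangentMap {ι : Type} [Fintype ι] (s : ι → S) (q : ι → F) : (ι → F) →ₗ[ℂ] V :=
  ∑ i, D (s i) (q i) ∘ₗ proj i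

variable {D} {ι κ : Type}

theorem sumTangentMap_apply [Fintype ι] (s : ι → S) (q u : ι → F) :
    sumTangentMap D s q u = ∑ i, D (s i) (q i) (u i) := by
  simp [sumTangentMap]

theorem range_sumTangentMap [Fintype ι] (s : ι → S) (q : ι → F) :
    range (sumTangentMap D s q) = tangentSum D s q := by
  classical
  apply le_antisymm
  · rintro _ ⟨u, rfl⟩
    rw [sumTangentMap_apply]
    exact sum_mem fun i _ =>
      Submodule.mem_iSup_of_mem (p := fun i => range (D (s i) (q i))) i ⟨u i, rfl⟩
  · refine iSup_le fun i => ?_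
    rintro _ ⟨u, rfl⟩
    refine ⟨Pi.single i u, ?_⟩
    rw [sumTangentMap_apply, Finset.sum_eq_single i]
    · simp
    · intro j _ hj
      simp [Pi.single_eq_of_ne hj]
    · simp

theorem tangentSum_comp_equiv (s : ι → S) (q : ι → F) (g : κ ≃ ι) :
    tangentSum D (s ∘ g) (q ∘ g) = tangentSum D s q :=
  g.iSup_comp (g := fun i => range (D (s i) (q i)))

theorem tangentSum_elim (s : ι → S) (a : S) (q : ι → F) (y : F) :
    tangentSum D (fun o : Option ι => o.elim a s) (fun o => o.elim y q) =
      range (D a y) ⊔ tangentSum D s q :=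
  iSup_option _

theorem isPolynomialMap_sumTangentMap [Fintype ι]
    (hD : ∀ a u, IsPolynomialMap fun t => D a t u) (s : ι → S) (u : ι → F) :
    IsPolynomialMap fun q => sumTangentMap D s q u := by
  simp only [sumTangentMap_apply]
  exact IsPolynomialMap.sum _ fun i _ => (hD (s i) (u i)).comp
    (proj (R := ℂ) (φ := fun _ : ι => F) i).isPolynomialMap

section

variable [FiniteDimensional ℂ V]

theorem finrank_tangentSum_le (s : ι → S) (q : ι → F) :
    finrank ℂ (tangentSum D s q) ≤ genericDim D s :=
  le_ciSup (f := fun q : ι → F => finrank ℂ (tangentSum D s q))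
    ⟨finrank ℂ V, by rintro _ ⟨q, rfl⟩; exact Submodule.finrank_le _⟩ q

theorem exists_finrank_tangentSum_eq (s : ι → S) :
    ∃ q : ι → F, finrank ℂ (tangentSum D s q) = genericDim D s :=
  Nat.sSup_mem (Set.range_nonempty _)
    ⟨finrank ℂ V, by rintro _ ⟨q, rfl⟩; exact Submodule.finrank_le _⟩

theorem genericDim_le_finrank (s : ι → S) : genericDim D s ≤ finrank ℂ V := by
  obtain ⟨q, hq⟩ := exists_finrank_tangentSum_eq (D := D) s
  exact hq ▸ Submodule.finrank_le _

theorem genericDim_comp_equiv (s : ι → S) (e : κ ≃ ι) :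
    genericDim D (s ∘ e) = genericDim D s := by
  apply le_antisymm
  · obtain ⟨q, hq⟩ := exists_finrank_tangentSum_eq (D := D) (s ∘ e)
    rw [← hq]
    refine le_trans (le_of_eq ?_) (finrank_tangentSum_le s (q ∘ e.symm))
    rw [← tangentSum_comp_equiv s _ e, Function.comp_assoc, e.symm_comp_self, Function.comp_id]
  · obtain ⟨q, hq⟩ := exists_finrank_tangentSum_eq (D := D) s
    rw [← hq, ← tangentSum_comp_equiv s q e]
    exact finrank_tangentSum_le _ _

theorem isGeneric_finrank_tangentSum [Finite ι] (hD : ∀ a u, IsPolynomialMap fun t => D a t u)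
    (s : ι → S) : IsGeneric {q : ι → F | finrank ℂ (tangentSum D s q) = genericDim D s} := by
  have := Fintype.ofFinite ι
  obtain ⟨q₀, hq₀⟩ := exists_finrank_tangentSum_eq (D := D) s
  obtain ⟨f, hf, hf0, h⟩ :=
    isGeneric_finrank_range_ge (sumTangentMap D s) (isPolynomialMap_sumTangentMap hD s) q₀
  refine ⟨f, hf, ⟨q₀, hf0⟩, fun q hq => ?_⟩
  have := h q hq
  rw [range_sumTangentMap, range_sumTangentMap, hq₀] at this
  exact le_antisymm (finrank_tangentSum_le s q) this

/-- Lets several subtuples of one large tuple be put in general position simultaneously; injectivity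
of `g` makes restriction to the subtuple surjective. -/
theorem isGeneric_finrank_tangentSum_comp [Finite κ] [Finite ι]
    (hD : ∀ a u, IsPolynomialMap fun t => D a t u) (s : κ → S) {g : κ → ι}
    (hg : Function.Injective g) :
    IsGeneric {q : ι → F | finrank ℂ (tangentSum D s (q ∘ g)) = genericDim D s} :=
  (isGeneric_finrank_tangentSum hD s).preimage (funLeft ℂ F g).isPolynomialMap
    (funLeft_surjective_of_injective ℂ F g hg)

/-- Submodularity of the generic dimension. -/
theorem genericDim_submodular [Finite ι] (hD : ∀ a u, IsPolynomialMap fun t => D a t u)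
    (s : ι → S) (a b : S) :
    genericDim D s + genericDim D (fun o : Option (Option ι) => o.elim a fun o => o.elim b s) ≤
      genericDim D (fun o : Option ι => o.elim a s) +
        genericDim D (fun o : Option ι => o.elim b s) := by
  have h1 := isGeneric_finrank_tangentSum hD
    (fun o : Option (Option ι) => o.elim a fun o => o.elim b s)
  have h2 := isGeneric_finrank_tangentSum_comp hD s
    (g := fun i => some (some i)) ((Option.some_injective _).comp (Option.some_injective _))
  obtain ⟨q, hq1, hq2⟩ := (h1.inter h2).nonempty
  have e1 : q = fun o => o.elim (q none) (q ∘ some) := by ext (_ | _) <;> rfl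
  have e2 : q ∘ some = fun o => o.elim (q (some none)) (q ∘ fun i => some (some i)) := by
    ext (_ | _) <;> rfl
  set r := q ∘ fun i => some (some i)
  have hA := finrank_tangentSum_le (D := D) (fun o : Option ι => o.elim a s)
    (fun o => o.elim (q none) r)
  have hB := finrank_tangentSum_le (D := D) (fun o : Option ι => o.elim b s)
    (fun o => o.elim (q (some none)) r)
  simp only [Set.mem_ofPred_eq] at hq1 hq2
  rw [e1, tangentSum_elim, e2, tangentSum_elim] at hq1
  rw [tangentSum_elim] at hA hB
  set A := range (D a (q none))
  set B := range (D b (q (some none)))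
  set W := tangentSum D s r
  -- The dimension formula for `A ⊔ W` and `B ⊔ W`, whose intersection contains `W`.
  have h3 := Submodule.finrank_sup_add_finrank_inf_eq (A ⊔ W) (B ⊔ W)
  have h4 : (A ⊔ W) ⊔ (B ⊔ W) = A ⊔ (B ⊔ W) := by
    rw [sup_assoc, sup_eq_right.2 (le_sup_right : W ≤ B ⊔ W)]
  have h5 : finrank ℂ W ≤ finrank ℂ ((A ⊔ W) ⊓ (B ⊔ W) : Submodule ℂ V) :=
    Submodule.finrank_mono (le_inf le_sup_right le_sup_right)
  rw [h4] at h3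
  omega

theorem genericDim_le_elim [Finite ι] (s : ι → S) (a : S) :
    genericDim D s ≤ genericDim D (fun o : Option ι => o.elim a s) := by
  obtain ⟨q, hq⟩ := exists_finrank_tangentSum_eq (D := D) s
  rw [← hq]
  refine le_trans ?_ (finrank_tangentSum_le _ (fun o => o.elim 0 q))
  rw [tangentSum_elim]
  exact Submodule.finrank_mono le_sup_right

end

variable (D) in
/-- A linear automorphism of `V` permuting the tangent spaces of each type. -/
def IsSymmetry (g : V ≃ₗ[ℂ] V) : Prop :=
  ∀ a, ∃ γ : F → F, Function.Surjective γ ∧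
    ∀ t, range (D a (γ t)) = (range (D a t)).map g.toLinearMap

variable (D) in
/-- A polynomial family of tangent spaces of generic dimension `c` whose symmetries act
irreducibly. -/
structure IsIrreducibleFamily (c : ℕ) : Prop where
  polynomial : ∀ a u, IsPolynomialMap fun t => D a t u
  isGeneric_finrank_eq : ∀ a, IsGeneric {t | finrank ℂ (range (D a t)) = c}
  irreducible : ∀ W : Submodule ℂ V, W ≠ ⊥ →
    (∀ g, IsSymmetry D g → ∀ x ∈ W, g x ∈ W) → W = ⊤

variable [FiniteDimensional ℂ V]

/-- The points of a tuple with index in `A` taken from the second copy, the others from the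
first one. -/
def hybridIndex [DecidableEq ι] (A : Finset ι) (i : ι) : Option (ι ⊕ ι) :=
  some (if i ∈ A then Sum.inr i else Sum.inl i)

theorem hybridIndex_injective [DecidableEq ι] (A : Finset ι) :
    Function.Injective (hybridIndex A) := by
  intro i j h
  simp only [hybridIndex, Option.some.injEq] at h
  split_ifs at h <;> simpa using h

theorem finrank_inf_add (A W : Submodule ℂ V) :
    finrank ℂ (A ⊓ W : Submodule ℂ V) + finrank ℂ (A ⊔ W : Submodule ℂ V) =
      finrank ℂ A + finrank ℂ W := by
  rw [add_comm, Submodule.finrank_sup_add_finrank_inf_eq]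

theorem elim_injective {g : κ → ι} (hg : Function.Injective g) {x : ι} (hx : ∀ i, g i ≠ x) :
    Function.Injective (fun o : Option κ => o.elim x g) := by
  rintro (_ | i) (_ | j) h
  · rfl
  · exact absurd h.symm (hx j)
  · exact absurd h (hx i)
  · exact congrArg some (hg h)

/-- Equality in submodularity says that adjoining the tangent space `R` at a fresh point of type `s
i` leaves `T ⊓ W` unchanged. The tangent sum with the `i`-th point replaced by the fresh one lies in
`R ⊔ W` and meets `T` in the same dimension, hence in the same subspace. Exchanging all points one
by one leads to an independent second copy. -/
theorem inf_tangentSum_hybrid_eq [Fintype ι] [DecidableEq ι]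
    (hD : ∀ a u, IsPolynomialMap fun t => D a t u)
    (s : ι → S) (a : S)
    (h : ∀ i, genericDim D s +
        genericDim D (fun o : Option (Option ι) => o.elim a fun o => o.elim (s i) s) =
      genericDim D (fun o : Option ι => o.elim a s) +
        genericDim D (fun o : Option ι => o.elim (s i) s)) :
    IsGeneric {q : Option (ι ⊕ ι) → F |
      range (D a (q none)) ⊓ tangentSum D s (q ∘ hybridIndex ∅) =
        range (D a (q none)) ⊓ tangentSum D s (q ∘ hybridIndex Finset.univ)} := by
  have hn : ∀ (A : Finset ι) i, hybridIndex A i ≠ none := fun A i => by simp [hybridIndex]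
  -- General position is imposed on all hybrid tuples at once, as there are finitely many of them.
  -- For `i ∉ A` the hybrid uses the first copy at `i`, so `Sum.inr i` is still fresh.
  have h1 := IsGeneric.iInter fun A : Finset ι =>
    isGeneric_finrank_tangentSum_comp hD s (hybridIndex_injective A)
  have h2 := IsGeneric.iInter fun A : Finset ι =>
    isGeneric_finrank_tangentSum_comp hD (fun o : Option ι => o.elim a s)
      (elim_injective (hybridIndex_injective A) (x := none) (hn A))
  have hx : ∀ x : {x : Finset ι × ι // x.2 ∉ x.1},
      ∀ i, hybridIndex x.1.1 i ≠ some (Sum.inr x.1.2) := by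
    rintro ⟨⟨A, j⟩, hj⟩ i
    simp only [hybridIndex, ne_eq, Option.some.injEq]
    split_ifs with hi
    · simp only [Sum.inr.injEq]
      rintro rfl
      exact hj hi
    · simp
  have h3 := IsGeneric.iInter fun x : {x : Finset ι × ι // x.2 ∉ x.1} =>
    isGeneric_finrank_tangentSum_comp hD (fun o : Option ι => o.elim (s x.1.2) s)
      (elim_injective (hybridIndex_injective x.1.1) (hx x))
  have h4 := IsGeneric.iInter fun x : {x : Finset ι × ι // x.2 ∉ x.1} =>
    isGeneric_finrank_tangentSum_comp hD
      (fun o : Option (Option ι) => o.elim a fun o => o.elim (s x.1.2) s)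
      (elim_injective (elim_injective (hybridIndex_injective x.1.1) (hx x)) (x := none)
        (by rintro (_ | i) <;> simp [hybridIndex]))
  refine (((h1.inter h2).inter h3).inter h4).mono ?_
  rintro q ⟨⟨⟨h1, h2⟩, h3⟩, h4⟩
  simp only [Set.mem_iInter, Set.mem_ofPred_eq] at h1 h2 h3 h4
  have comp_elim : ∀ {κ : Type} (g : κ → Option (ι ⊕ ι)) (x : Option (ι ⊕ ι)),
      (q ∘ fun o : Option κ => o.elim x g) = fun o => o.elim (q x) (q ∘ g) := by
    intro κ g x
    ext (_ | _) <;> rfl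
  set T := range (D a (q none)) with hT
  set W : Finset ι → Submodule ℂ V := fun A => tangentSum D s (q ∘ hybridIndex A) with hW
  replace h1 : ∀ A, finrank ℂ (W A) = genericDim D s := h1
  replace h2 : ∀ A, finrank ℂ (T ⊔ W A : Submodule ℂ V) =
      genericDim D (fun o : Option ι => o.elim a s) := fun A => by
    have := h2 A
    rwa [comp_elim, tangentSum_elim] at this
  replace h3 : ∀ A i, i ∉ A → finrank ℂ (range (D (s i) (q (some (Sum.inr i)))) ⊔ W A :
      Submodule ℂ V) = genericDim D (fun o : Option ι => o.elim (s i) s) := fun A i hi => by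
    have := h3 ⟨(A, i), hi⟩
    rwa [comp_elim, tangentSum_elim] at this
  replace h4 : ∀ A i, i ∉ A → finrank ℂ (T ⊔ (range (D (s i) (q (some (Sum.inr i)))) ⊔ W A) :
      Submodule ℂ V) =
        genericDim D (fun o : Option (Option ι) => o.elim a fun o => o.elim (s i) s) :=
    fun A i hi => by
    have := h4 ⟨(A, i), hi⟩
    rwa [comp_elim, comp_elim, tangentSum_elim, tangentSum_elim] at this
  have hfin : ∀ A, finrank ℂ (T ⊓ W A : Submodule ℂ V) = finrank ℂ (T ⊓ W ∅ : Submodule ℂ V) := by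
    intro A
    have e1 := finrank_inf_add T (W A)
    have e2 := finrank_inf_add T (W ∅)
    have := h1 A
    have := h1 ∅
    have := h2 A
    have := h2 ∅
    omega
  have step : ∀ A i, i ∉ A → T ⊓ W (insert i A) = T ⊓ W A := by
    intro A i hi
    set R := range (D (s i) (q (some (Sum.inr i)))) with hR
    have e1 : T ⊓ W A = T ⊓ (R ⊔ W A) := by
      refine Submodule.eq_of_le_of_finrank_eq (inf_le_inf_left _ le_sup_right) ?_
      have e1 := finrank_inf_add T (W A)
      have e2 := finrank_inf_add T (R ⊔ W A)
      have := h1 A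
      have := h2 A
      have := h3 A i hi
      have := h4 A i hi
      rw [← hR] at *
      have := h i
      omega
    refine Submodule.eq_of_le_of_finrank_eq ?_ ((hfin _).trans (hfin _).symm)
    rw [e1]
    refine inf_le_inf_left _ (iSup_le fun j => ?_)
    by_cases hj : j ∈ A
    · refine le_sup_of_le_right (le_iSup_of_le j ?_)
      simp [hybridIndex, hj]
    · by_cases hji : j = i
      · subst hji
        refine le_sup_of_le_left ?_
        simp [hybridIndex, hR]
      · refine le_sup_of_le_right (le_iSup_of_le j ?_)
        simp [hybridIndex, hj, hji]
  have : ∀ A, T ⊓ W A = T ⊓ W ∅ := by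
    intro A
    induction A using Finset.induction_on with
    | empty => rfl
    | insert i A hi ih => rw [step A i hi, ih]
  exact (this Finset.univ).symm

/-- If adding a further point of any of the types already present does not enlarge the generic
intersection with a tangent space of type `a`, then that intersection is zero or the tangent
spaces span everything. -/
theorem IsIrreducibleFamily.genericDim_eq [Finite ι] [FiniteDimensional ℂ F] {c : ℕ}
    (hD : IsIrreducibleFamily D c) (s : ι → S) (a : S)
    (h : ∀ i, genericDim D s +
        genericDim D (fun o : Option (Option ι) => o.elim a fun o => o.elim (s i) s) =
      genericDim D (fun o : Option ι => o.elim a s) +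
        genericDim D (fun o : Option ι => o.elim (s i) s))
    (hlt : genericDim D (fun o : Option ι => o.elim a s) < genericDim D s + c) :
    genericDim D s = finrank ℂ V := by
  classical
  have := Fintype.ofFinite ι
  have hg1 := inf_tangentSum_hybrid_eq hD.polynomial s a h
  have hg2 := (hD.isGeneric_finrank_eq a).preimage (P := Option (ι ⊕ ι) → F)
    (proj (R := ℂ) (φ := fun _ => F) none).isPolynomialMap
    (proj_surjective (R := ℂ) (φ := fun _ => F) none)
  have hg3 := isGeneric_finrank_tangentSum_comp hD.polynomial s (hybridIndex_injective (∅ : Finset ι))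
  obtain ⟨f, hf, ⟨q₀, hq₀⟩, hgen⟩ := (hg1.inter hg2).inter hg3
  have hempty : hybridIndex (∅ : Finset ι) = fun i => some (Sum.inl i) := by
    ext i : 1; simp [hybridIndex]
  have huniv : hybridIndex (Finset.univ : Finset ι) = fun i => some (Sum.inr i) := by
    ext i : 1; simp [hybridIndex]
  obtain ⟨⟨h1, h2⟩, h3⟩ := hgen q₀ hq₀
  simp only [Set.mem_ofPred_eq, Set.mem_preimage, proj_apply, hempty, huniv] at h1 h2 h3 hgen
  rw [hempty] at h3
  set q : ι → F := q₀ ∘ fun i => some (Sum.inl i) with hq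
  set y := q₀ none with hy
  -- `hlt` rules out a direct sum.
  obtain ⟨v, hv, hv0⟩ : ∃ v ∈ range (D a y) ⊓ tangentSum D s q, v ≠ 0 := by
    apply Submodule.exists_mem_ne_zero_of_ne_bot
    intro hbot
    have e1 := finrank_inf_add (range (D a y)) (tangentSum D s q)
    have e2 := finrank_tangentSum_le (D := D) (fun o : Option ι => o.elim a s)
      (fun o => o.elim y q)
    rw [tangentSum_elim] at e2
    rw [hbot, finrank_bot] at e1
    omega
  -- `y` and `q`, hence `v`, are frozen; only the second copy varies, so `v` lies in the tangent sum
  -- at a general `q'`.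
  let ψ : (ι → F) → (Option (ι ⊕ ι) → F) := fun q' o => o.elim y (Sum.elim q q')
  have hψ : IsPolynomialMap ψ := by
    refine isPolynomialMap_pi ?_
    rintro (_ | i | i)
    · exact isPolynomialMap_const y
    · exact isPolynomialMap_const (q i)
    · exact (proj (R := ℂ) (φ := fun _ => F) i).isPolynomialMap
  have hψ0 : ψ (q₀ ∘ fun i => some (Sum.inr i)) = q₀ := by
    ext (_ | i | i) <;> rfl
  have hfψ : ∀ q', f (ψ q') ≠ 0 → v ∈ tangentSum D s q' := by
    intro q' hq'
    have e1 := (hgen _ hq').1.1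
    have e2 : v ∈ range (D a y) ⊓ tangentSum D s q' := by
      have e3 : range (D a y) ⊓ tangentSum D s q = range (D a y) ⊓ tangentSum D s q' := e1
      rwa [← e3]
    exact e2.2
  have hall : ∀ q', finrank ℂ (tangentSum D s q') = genericDim D s → v ∈ tangentSum D s q' := by
    intro q' hq'
    by_contra hvq
    -- If `v` were outside the tangent sum at `q'`, adjoining it would raise the rank above the
    -- generic dimension there, hence also at general points, where `v` adds nothing.
    let L : (ι → F) → ((ι → F) × ℂ) →ₗ[ℂ] V := fun p =>
      (sumTangentMap D s p).coprod (toSpanSingleton ℂ V v)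
    have hrange : ∀ p, range (L p) = tangentSum D s p ⊔ ℂ ∙ v := by
      intro p
      rw [range_coprod, range_sumTangentMap, range_toSpanSingleton]
    obtain ⟨g, hg, hg0, hg1⟩ := isGeneric_finrank_range_ge L (fun u => by
      simp only [L, coprod_apply]
      exact (isPolynomialMap_sumTangentMap hD.polynomial s u.1).add (isPolynomialMap_const _)) q'
    obtain ⟨p, hp1, hp2⟩ := exists_mul_apply_ne_zero hg (hψ.comp_mem hf) hg0 (by rwa [hψ0])
    have hp := hg1 p hp1
    have hvp := hfψ p hp2
    rw [hrange, hrange, sup_eq_left.2 ((Submodule.span_singleton_le_iff_mem _ _).2 hvp)] at hp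
    have h5 : tangentSum D s q' < tangentSum D s q' ⊔ ℂ ∙ v := by
      rw [left_lt_sup, Submodule.span_singleton_le_iff_mem]
      exact hvq
    have h6 := Submodule.finrank_lt_finrank_of_lt h5
    have h7 := finrank_tangentSum_le (D := D) s p
    omega
  let W : Submodule ℂ V := ⨅ q' ∈ {q' : ι → F | finrank ℂ (tangentSum D s q') = genericDim D s},
    tangentSum D s q'
  have hW : W = ⊤ := by
    refine hD.irreducible W ?_ ?_
    · refine fun hbot => hv0 ((Submodule.mem_bot ℂ).1 (hbot ▸ ?_))
      exact (Submodule.mem_iInf _).2 fun q' => (Submodule.mem_iInf _).2 fun hq' => hall q' hq'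
    · intro g hg x hx
      refine (Submodule.mem_iInf _).2 fun q' => (Submodule.mem_iInf _).2 fun hq' => ?_
      choose γ hγ hγ' using hg
      -- Surjectivity of `γ` makes every tuple of generic dimension the translate by `g` of another
      -- such tuple, so `g` preserves the intersection `W`.
      choose p hp using fun i => hγ (s i) (q' i)
      have e1 : tangentSum D s q' = (tangentSum D s p).map g.toLinearMap := by
        rw [tangentSum, tangentSum, Submodule.map_iSup]
        exact iSup_congr fun i => by rw [← hγ', hp]
      have e2 : finrank ℂ (tangentSum D s p) = genericDim D s := by
        rw [← hq', e1]
        exact (LinearEquiv.finrank_map_eq g _).symm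
      rw [e1]
      exact ⟨x, (Submodule.mem_iInf _).1 ((Submodule.mem_iInf _).1 hx p) e2, rfl⟩
  have hqW : W ≤ tangentSum D s q := iInf₂_le (f := fun q' _ => tangentSum D s q') q h3
  rw [hW, top_le_iff] at hqW
  rw [← h3, hqW, finrank_top]

/-- Starting from a defective configuration one fills the space by adding fewer than `c`
points. -/
theorem IsIrreducibleFamily.exists_genericDim_eq [FiniteDimensional ℂ F] {c : ℕ}
    (hD : IsIrreducibleFamily D c) (e : ℕ) : ∀ {ι : Type} [Finite ι] (s : ι → S) (a : S),
    genericDim D (fun o : Option ι => o.elim a s) < genericDim D s + c →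
    genericDim D (fun o : Option ι => o.elim a s) ≤ genericDim D s + e →
    ∃ (m : ℕ) (s' : Fin m → S), m ≤ Nat.card ι + e ∧ genericDim D s' = finrank ℂ V := by
  induction e with
  | zero =>
    intro ι _ s a h1 h2
    by_cases h : ∀ i, genericDim D s +
        genericDim D (fun o : Option (Option ι) => o.elim a fun o => o.elim (s i) s) =
      genericDim D (fun o : Option ι => o.elim a s) +
        genericDim D (fun o : Option ι => o.elim (s i) s)
    · have e := (Finite.equivFin ι).symm
      exact ⟨_, s ∘ e, le_rfl, (genericDim_comp_equiv s e).trans (hD.genericDim_eq s a h h1)⟩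
    · push Not at h
      obtain ⟨i, hi⟩ := h
      -- The gain of `a` is already zero and cannot drop further, so strict submodularity is
      -- impossible.
      have e1 := genericDim_submodular hD.polynomial s a (s i)
      have e2 := genericDim_le_elim (D := D) (fun o : Option ι => o.elim (s i) s) a
      omega
  | succ e ih =>
    intro ι _ s a h1 h2
    by_cases h : ∀ i, genericDim D s +
        genericDim D (fun o : Option (Option ι) => o.elim a fun o => o.elim (s i) s) =
      genericDim D (fun o : Option ι => o.elim a s) +
        genericDim D (fun o : Option ι => o.elim (s i) s)
    · have e := (Finite.equivFin ι).symm
      exact ⟨_, s ∘ e, by omega, (genericDim_comp_equiv s e).trans (hD.genericDim_eq s a h h1)⟩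
    · push Not at h
      obtain ⟨i, hi⟩ := h
      have e1 := genericDim_submodular hD.polynomial s a (s i)
      -- One more point lowers the gain of `a` by at least one, so the bound on the number of points
      -- plus the gain is preserved.
      obtain ⟨m, s', hm, hs'⟩ := ih (fun o : Option ι => o.elim (s i) s) a (by omega) (by omega)
      refine ⟨m, s', ?_, hs'⟩
      rw [Finite.card_option] at hm
      omega

theorem genericDim_of_isEmpty [IsEmpty ι] (s : ι → S) : genericDim D s = 0 := by
  obtain ⟨q, hq⟩ := exists_finrank_tangentSum_eq (D := D) s
  rw [← hq, tangentSum, iSup_of_empty, finrank_bot]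

theorem IsIrreducibleFamily.genericDim_elim_le {c : ℕ}
    (hD : IsIrreducibleFamily D c) [Finite ι]
    (s : ι → S) (a : S) : genericDim D (fun o : Option ι => o.elim a s) ≤ genericDim D s + c := by
  obtain ⟨q, hq, e2⟩ := ((isGeneric_finrank_tangentSum hD.polynomial
    (fun o : Option ι => o.elim a s)).inter ((hD.isGeneric_finrank_eq a).preimage
      (proj (R := ℂ) (φ := fun _ => F) none).isPolynomialMap
      (proj_surjective (R := ℂ) (φ := fun _ => F) none))).nonempty
  have e1 : q = fun o => o.elim (q none) (q ∘ some) := by ext (_ | _) <;> rfl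
  simp only [Set.mem_ofPred_eq, Set.mem_preimage, proj_apply] at hq e2
  rw [← hq, e1, tangentSum_elim]
  have e3 := finrank_tangentSum_le (D := D) s (q ∘ some)
  have e4 := finrank_inf_add (range (D a (q none))) (tangentSum D s (q ∘ some))
  omega

theorem IsIrreducibleFamily.genericDim_le_mul {c : ℕ} (hD : IsIrreducibleFamily D c) [Finite ι]
    (s : ι → S) : genericDim D s ≤ c * Nat.card ι := by
  induction ι using Finite.induction_empty_option with
  | of_equiv e ih =>
    rw [← Nat.card_congr e, ← genericDim_comp_equiv s e]
    exact ih _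
  | h_empty => simp [genericDim_of_isEmpty]
  | h_option ih =>
    rename_i ι _
    rw [Finite.card_option, mul_add, mul_one]
    have hs : s = fun o : Option ι => o.elim (s none) (s ∘ some) := by ext (_ | _) <;> rfl
    have h2 := ih (s ∘ some)
    have h3 := hD.genericDim_elim_le (s ∘ some) (s none)
    rw [← hs] at h3
    omega

/-- Few points impose independent conditions: their tangent spaces are generically in direct
sum. -/
theorem IsIrreducibleFamily.genericDim_eq_mul [FiniteDimensional ℂ F] {c : ℕ}
    (hD : IsIrreducibleFamily D c) [Finite ι] (s : ι → S)
    (h : c * (Nat.card ι + c) < finrank ℂ V) : genericDim D s = c * Nat.card ι := by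
  induction ι using Finite.induction_empty_option with
  | of_equiv e ih =>
    rw [← Nat.card_congr e] at h ⊢
    rw [← genericDim_comp_equiv s e]
    exact ih _ h
  | h_empty => simp [genericDim_of_isEmpty]
  | h_option ih =>
    rename_i ι _
    rw [Finite.card_option] at h ⊢
    have hs : s = fun o : Option ι => o.elim (s none) (s ∘ some) := by ext (_ | _) <;> rfl
    have h1 : c * (Nat.card ι + c) ≤ c * (Nat.card ι + 1 + c) :=
      Nat.mul_le_mul_left c (by omega)
    have h2 := ih (s ∘ some) (by omega)
    have h3 := hD.genericDim_elim_le (s ∘ some) (s none)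
    rw [← hs] at h3
    by_contra hne
    have h4 : genericDim D s < genericDim D (s ∘ some) + c := by
      rw [mul_add, mul_one] at hne
      omega
    rw [hs] at h3 h4
    -- A defect at the last point would fill the space with at most `Nat.card ι + c` points, which
    -- span too little.
    obtain ⟨m, s', hm, hs'⟩ := hD.exists_genericDim_eq c (s ∘ some) (s none) h4 h3
    have h5 := hD.genericDim_le_mul s'
    rw [Nat.card_fin] at h5
    have h6 : c * m ≤ c * (Nat.card ι + c) := Nat.mul_le_mul_left c hm
    omega

/-- Some number of points of at most `dim V / c + c` fills the space. -/
theorem IsIrreducibleFamily.exists_genericDim_eq_finrank [FiniteDimensional ℂ F] {c : ℕ}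
    (hD : IsIrreducibleFamily D c) [Nonempty S] (hc : 1 ≤ c) :
    ∃ (m : ℕ) (s : Fin m → S), genericDim D s = finrank ℂ V ∧
      c * m ≤ finrank ℂ V + c * c := by
  obtain ⟨a⟩ := ‹Nonempty S›
  by_cases h : ∀ m, genericDim D (fun _ : Fin m => a) = c * m
  · have h1 := h (finrank ℂ V + 1)
    have h2 := genericDim_le_finrank (D := D) (fun _ : Fin (finrank ℂ V + 1) => a)
    nlinarith
  · push Not at h
    classical
    obtain ⟨m, hm, hmin⟩ := Nat.findX h
    rcases m with _ | m
    · simp [genericDim_of_isEmpty] at hm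
    · have hm' : genericDim D (fun _ : Fin m => a) = c * m := by
        by_contra h0
        exact hmin m (Nat.lt_succ_self m) h0
      let e : Option (Fin m) ≃ Fin (m + 1) := (finSuccEquiv m).symm
      have h1 := genericDim_comp_equiv (D := D) (fun _ : Fin (m + 1) => a) e
      have h2 : ((fun _ : Fin (m + 1) => a) ∘ e) =
          fun o : Option (Fin m) => o.elim a (fun _ => a) := by ext (_ | _) <;> rfl
      rw [h2] at h1
      have h3 := hD.genericDim_elim_le (fun _ : Fin m => a) a
      have h4 : genericDim D (fun o : Option (Fin m) => o.elim a (fun _ => a)) <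
          genericDim D (fun _ : Fin m => a) + c := by
        rw [mul_add, mul_one] at hm
        omega
      obtain ⟨m', s', hm', hs'⟩ := hD.exists_genericDim_eq c (fun _ : Fin m => a) a h4 h3
      refine ⟨m', s', hs', ?_⟩
      rw [Nat.card_fin] at hm'
      have h5 := genericDim_le_finrank (D := D) (fun _ : Fin m => a)
      calc c * m' ≤ c * (m + c) := Nat.mul_le_mul_left c hm'
        _ = c * m + c * c := mul_add _ _ _
        _ ≤ _ := by omega

end TangentSums

/-! ### Products of arrays on blocks, their tangent spaces and a normalised parametrization. -/

section BlockProducts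

open Module

variable {L N Δ : Type} {K : L → Type}

/-- Families of arrays, one for each block. -/
abbrev BlockArrays (N : Type) (K : L → Type) : Type := ∀ i, (K i → N) → ℂ

/-- The restriction of a word to a block. -/
def subword (β : (Σ i, K i) ≃ Δ) (I : Δ → N) (i : L) : K i → N := fun a => I (β ⟨i, a⟩)

theorem subword_glue (β : (Σ i, K i) ≃ Δ) (w : ∀ i, K i → N) (i : L) :
    subword β (fun δ => w (β.symm δ).1 (β.symm δ).2) i = w i := by
  ext a
  show w (β.symm (β ⟨i, a⟩)).1 (β.symm (β ⟨i, a⟩)).2 = _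
  rw [β.symm_apply_apply]

theorem apply_mem_polynomialFunctionAlgebra (i : L) (w : K i → N) :
    (fun t : BlockArrays N K => t i w) ∈ polynomialFunctionAlgebra (BlockArrays N K) :=
  dual_mem_polynomialFunctionAlgebra
    (LinearMap.proj w ∘ₗ LinearMap.proj (R := ℂ) (φ := fun i => (K i → N) → ℂ) i)

section

variable [Fintype L]

/-- The array that is a product of arrays on the blocks. -/
def blockProduct (β : (Σ i, K i) ≃ Δ) :
    MultilinearMap ℂ (fun i => (K i → N) → ℂ) ((Δ → N) → ℂ) :=
  MultilinearMap.pi fun I => (MultilinearMap.mkPiAlgebra ℂ L ℂ).compLinearMap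
    fun i => LinearMap.proj (subword β I i)

@[simp]
theorem blockProduct_apply (β : (Σ i, K i) ≃ Δ) (t : BlockArrays N K) (I : Δ → N) :
    blockProduct β t I = ∏ i, t i (subword β I i) := rfl

theorem isPolynomialMap_of_mem {P : Type*} [AddCommGroup P] [Module ℂ P] {f : P → ℂ}
    (hf : f ∈ polynomialFunctionAlgebra P) : IsPolynomialMap f := by
  intro φ
  have : (fun p => φ (f p)) = (fun _ => φ 1) * f := by
    ext p
    rw [Pi.mul_apply, mul_comm, ← smul_eq_mul, ← map_smul, smul_eq_mul, mul_one]
  rw [this]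
  exact mul_mem (const_mem_polynomialFunctionAlgebra _) hf

theorem isPolynomialMap_blockProduct [Finite Δ] [Finite N] (β : (Σ i, K i) ≃ Δ) {P : Type*} [AddCommGroup P]
    [Module ℂ P] {Ψ : P → BlockArrays N K}
    (hΨ : ∀ i w, (fun p => Ψ p i w) ∈ polynomialFunctionAlgebra P) :
    IsPolynomialMap fun p => blockProduct β (Ψ p) := by
  refine isPolynomialMap_pi fun I => isPolynomialMap_of_mem ?_
  have : (fun p => blockProduct β (Ψ p) I) = ∏ i, fun p => Ψ p i (subword β I i) := by
    ext p
    simp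
  rw [this]
  exact prod_mem fun i _ => hΨ i _

variable [DecidableEq L]

/-- The derivative of the block product. -/
noncomputable def blockTangent (β : (Σ i, K i) ≃ Δ) (t : BlockArrays N K) :
    BlockArrays N K →ₗ[ℂ] ((Δ → N) → ℂ) :=
  (blockProduct β).linearDeriv t

theorem blockTangent_apply (β : (Σ i, K i) ≃ Δ) (t u : BlockArrays N K) :
    blockTangent β t u = ∑ i, blockProduct β (Function.update t i (u i)) :=
  MultilinearMap.linearDeriv_apply _ _ _

theorem blockTangent_single (β : (Σ i, K i) ≃ Δ) (t : BlockArrays N K) (i : L)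
    (x : (K i → N) → ℂ) :
    blockTangent β t (Pi.single i x) = blockProduct β (Function.update t i x) := by
  rw [blockTangent_apply, Finset.sum_eq_single i]
  · simp
  · intro j _ hj
    rw [Pi.single_eq_of_ne hj]
    exact (blockProduct β).map_update_zero t j
  · simp

theorem isPolynomialMap_blockTangent [Finite Δ] [Finite N] (β : (Σ i, K i) ≃ Δ) (u : BlockArrays N K) :
    IsPolynomialMap fun t => blockTangent β t u := by
  simp only [blockTangent_apply]
  refine IsPolynomialMap.sum _ fun i _ => isPolynomialMap_blockProduct β fun j w => ?_
  by_cases h : j = i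
  · subst h
    simpa using const_mem_polynomialFunctionAlgebra _
  · simpa [Function.update_of_ne h] using apply_mem_polynomialFunctionAlgebra j w

end

/-- Index set of the parameters of the normalised block product: a scalar, and for each block the
entries of an array apart from one that is normalised. -/
abbrev NormalIndex (w₀ : ∀ i, K i → N) : Type := Option (Σ i, {w : K i → N // w ≠ w₀ i})

/-- Arrays with prescribed entry `1` at the words `w₀ i`. -/
noncomputable def normalArrays (w₀ : ∀ i, K i → N) (z : NormalIndex w₀ → ℂ) : BlockArrays N K :=
  open Classical in fun i w => if h : w = w₀ i then 1 else z (some ⟨i, w, h⟩)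

/-- This count is the constant `c` of the theorem, written without truncated subtraction. -/
theorem card_normalIndex [Fintype L] [Finite N] [∀ i, Finite (K i)] (w₀ : ∀ i, K i → N) :
    Nat.card (NormalIndex w₀) + Fintype.card L = (∑ i, Nat.card N ^ Nat.card (K i)) + 1 := by
  classical
  have := Fintype.ofFinite N
  have := fun i => Fintype.ofFinite (K i)
  rw [Finite.card_option, Nat.card_sigma]
  have h : ∀ i, Nat.card {w : K i → N // w ≠ w₀ i} + 1 = Nat.card N ^ Nat.card (K i) := by
    intro i
    rw [Nat.card_eq_fintype_card, Fintype.card_subtype_compl, Fintype.card_subtype_eq,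
      ← Nat.card_fun, Nat.card_eq_fintype_card]
    exact Nat.sub_add_cancel (Fintype.card_pos_iff.2 ⟨w₀ i⟩)
  have h2 := Finset.sum_congr rfl fun i (_ : i ∈ Finset.univ) => h i
  rw [Finset.sum_add_distrib] at h2
  simp only [Finset.sum_const, Finset.card_univ, smul_eq_mul, mul_one] at h2
  omega

section

variable [Fintype L]

/-- The normalised parametrization of block products. -/
noncomputable def normalBlockProduct (β : (Σ i, K i) ≃ Δ) (w₀ : ∀ i, K i → N)
    (z : NormalIndex w₀ → ℂ) : (Δ → N) → ℂ :=
  z none • blockProduct β (normalArrays w₀ z)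

theorem isPolynomialMap_normalBlockProduct [Finite Δ] [Finite N] (β : (Σ i, K i) ≃ Δ) (w₀ : ∀ i, K i → N) :
    IsPolynomialMap (normalBlockProduct β w₀) := by
  classical
  intro φ
  have h : IsPolynomialMap fun z => blockProduct β (normalArrays w₀ z) := by
    refine isPolynomialMap_blockProduct β fun i w => ?_
    unfold normalArrays
    split_ifs with hw
    · exact const_mem_polynomialFunctionAlgebra 1
    · exact dual_mem_polynomialFunctionAlgebra (LinearMap.proj (R := ℂ) (φ := fun _ => ℂ) _)
  have h2 : (fun z => φ (normalBlockProduct β w₀ z)) =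
      (fun z => z none) * fun z => φ (blockProduct β (normalArrays w₀ z)) := by
    ext z
    simp [normalBlockProduct]
  rw [h2]
  exact mul_mem
    (dual_mem_polynomialFunctionAlgebra (LinearMap.proj (R := ℂ) (φ := fun _ => ℂ) none)) (h φ)

/-- Scale every factor to have entry `1` at its base word and collect the scalars in the coordinate
`none`. -/
theorem exists_normalBlockProduct_eq (β : (Σ i, K i) ≃ Δ) (w₀ : ∀ i, K i → N)
    {t : BlockArrays N K} (ht : ∀ i, t i (w₀ i) ≠ 0) :
    ∃ z, normalBlockProduct β w₀ z = blockProduct β t := by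
  classical
  refine ⟨fun o => o.elim (∏ i, t i (w₀ i)) fun x => (t x.1 (w₀ x.1))⁻¹ * t x.1 x.2, ?_⟩
  ext I
  simp only [normalBlockProduct, Pi.smul_apply, blockProduct_apply, Option.elim_none, smul_eq_mul,
    ← Finset.prod_mul_distrib]
  refine Finset.prod_congr rfl fun i _ => ?_
  unfold normalArrays
  split_ifs with h
  · simp [h]
  · simp [mul_inv_cancel_left₀ (ht i)]

theorem isGeneric_forall_ne_zero (w₀ : ∀ i, K i → N) :
    IsGeneric {t : BlockArrays N K | ∀ i, t i (w₀ i) ≠ 0} := by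
  refine ⟨∏ i, fun t => t i (w₀ i), prod_mem fun i _ => apply_mem_polynomialFunctionAlgebra i _,
    ⟨fun _ _ => 1, by simp⟩, fun t ht i h => ht ?_⟩
  rw [Finset.prod_apply]
  exact Finset.prod_eq_zero (Finset.mem_univ i) h

variable [DecidableEq L]

/-- The partial derivatives span the tangent space. Euler's relation in block `i` writes the product
itself as a combination of the partials of that block, with coefficient `t i (w₀ i) ≠ 0` at the base
word. So one vector, the product, replaces the base partials of all blocks. -/
theorem finrank_range_blockTangent_le [Finite N] [∀ i, Finite (K i)] (β : (Σ i, K i) ≃ Δ) (w₀ : ∀ i, K i → N)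
    {t : BlockArrays N K} (ht : ∀ i, t i (w₀ i) ≠ 0) :
    finrank ℂ (LinearMap.range (blockTangent β t)) ≤ Nat.card (NormalIndex w₀) := by
  classical
  have := Fintype.ofFinite N
  have := fun i => Fintype.ofFinite (K i)
  let b : NormalIndex w₀ → ((Δ → N) → ℂ) := fun o =>
    o.elim (blockProduct β t) fun x => blockTangent β t (Pi.single x.1 (Pi.single x.2.1 1))
  have hsum : ∀ i (x : (K i → N) → ℂ), blockTangent β t (Pi.single i x) =
      ∑ w, x w • blockTangent β t (Pi.single i (Pi.single w 1)) := by
    intro i x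
    have h := map_sum (blockTangent β t ∘ₗ LinearMap.single ℂ (fun i => (K i → N) → ℂ) i)
      (fun w => x w • (Pi.single w 1 : (K i → N) → ℂ)) Finset.univ
    simp only [map_smul] at h
    have h2 : ∑ w, x w • (Pi.single w 1 : (K i → N) → ℂ) = x := by
      ext w
      simp [Finset.sum_apply, Pi.single_apply]
    rwa [h2] at h
  have hb : ∀ i w, blockTangent β t (Pi.single i (Pi.single w 1)) ∈
      Submodule.span ℂ (Set.range b) := by
    intro i w
    have hne : ∀ w ≠ w₀ i, blockTangent β t (Pi.single i (Pi.single w 1)) ∈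
        Submodule.span ℂ (Set.range b) :=
      fun w hw => Submodule.subset_span ⟨some ⟨i, w, hw⟩, rfl⟩
    by_cases hw : w = w₀ i
    · subst hw
      have h1 : blockProduct β t ∈ Submodule.span ℂ (Set.range b) :=
        Submodule.subset_span ⟨none, rfl⟩
      have h2 : blockProduct β t = ∑ w, t i w • blockTangent β t (Pi.single i (Pi.single w 1)) := by
        have h3 : blockTangent β t (Pi.single i (t i)) = blockProduct β t := by
          rw [blockTangent_single, Function.update_eq_self]
        rw [← h3, hsum]
      rw [h2, ← Finset.add_sum_erase _ _ (Finset.mem_univ (w₀ i))] at h1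
      have h3 := (Submodule.add_mem_iff_left _ (Submodule.sum_mem _ fun w hw =>
        Submodule.smul_mem _ (t i w) (hne w (Finset.ne_of_mem_erase hw)))).1 h1
      exact (Submodule.smul_mem_iff _ (ht i)).1 h3
    · exact hne w hw
  have hle : LinearMap.range (blockTangent β t) ≤ Submodule.span ℂ (Set.range b) := by
    rintro _ ⟨u, rfl⟩
    rw [← Finset.univ_sum_single u, map_sum]
    refine sum_mem fun i _ => ?_
    rw [hsum]
    exact sum_mem fun w _ => Submodule.smul_mem _ _ (hb i w)
  have := Fintype.ofFinite (NormalIndex w₀)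
  have := FiniteDimensional.span_of_finite ℂ (Set.finite_range b)
  refine (Submodule.finrank_mono hle).trans ?_
  rw [Nat.card_eq_fintype_card]
  exact finrank_range_le_card b

/-- At a product of unit arrays the tangent space contains the unit arrays at all words that differ
from the base word in at most one block; `NormalIndex w₀` enumerates exactly these. -/
theorem le_finrank_range_blockTangent [Finite Δ] [Finite N] [∀ i, Finite (K i)] (β : (Σ i, K i) ≃ Δ) (w₀ : ∀ i, K i → N)
    [Nonempty L] : ∃ t : BlockArrays N K,
    Nat.card (NormalIndex w₀) ≤ finrank ℂ (LinearMap.range (blockTangent β t)) := by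
  classical
  have := Fintype.ofFinite N
  have := Fintype.ofFinite Δ
  have := Fintype.ofFinite (NormalIndex w₀)
  let t : BlockArrays N K := fun i => Pi.single (w₀ i) 1
  let glue : (∀ i, K i → N) → (Δ → N) := fun w δ => w (β.symm δ).1 (β.symm δ).2
  let J : NormalIndex w₀ → (Δ → N) := fun o =>
    glue (o.elim w₀ fun x => Function.update w₀ x.1 x.2)
  have hglue : ∀ w I, (∀ i, subword β I i = w i) ↔ I = glue w := by
    intro w I
    constructor
    · intro h
      ext δ
      have := congrFun (h (β.symm δ).1) (β.symm δ).2
      simpa [subword, glue] using this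
    · rintro rfl i
      exact subword_glue β w i
  have hprod : ∀ w : ∀ i, K i → N,
      blockProduct β (fun i => Pi.single (w i) 1) = Pi.single (glue w) 1 := by
    intro w
    ext I
    rw [blockProduct_apply]
    by_cases h : I = glue w
    · rw [h, Pi.single_eq_same]
      refine Finset.prod_eq_one fun i _ => ?_
      rw [subword_glue β w i, Pi.single_eq_same]
    · rw [Pi.single_eq_of_ne h]
      have : ∃ i, subword β I i ≠ w i := by
        by_contra! hall
        exact h ((hglue w I).1 hall)
      obtain ⟨i, hi⟩ := this
      exact Finset.prod_eq_zero (Finset.mem_univ i) (Pi.single_eq_of_ne hi _)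
  have hinj : Function.Injective J := by
    have hg : Function.Injective glue := by
      intro w w' h
      ext1 i
      rw [← subword_glue β w i, ← subword_glue β w' i]
      exact congrArg (fun I => subword β I i) h
    refine hg.comp ?_
    rintro (_ | ⟨i, w, hw⟩) (_ | ⟨j, w', hw'⟩) h
    · rfl
    · exact absurd (by simpa using (congrFun h j).symm) hw'
    · exact absurd (by simpa using congrFun h i) hw
    · simp only at h
      by_cases hij : i = j
      · subst hij
        have := congrFun h i
        simp only [Function.update_self] at this
        subst this
        rfl
      · exact absurd (by simpa [Function.update_of_ne hij] using congrFun h i) hw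
  have hmem : ∀ o, (Pi.single (J o) 1 : (Δ → N) → ℂ) ∈ LinearMap.range (blockTangent β t) := by
    rintro (_ | ⟨i, w, hw⟩)
    · obtain ⟨i⟩ := ‹Nonempty L›
      refine ⟨Pi.single i (t i), ?_⟩
      rw [blockTangent_single, Function.update_eq_self]
      exact hprod w₀
    · refine ⟨Pi.single i (Pi.single w 1), ?_⟩
      rw [blockTangent_single]
      have : Function.update t i (Pi.single w 1) =
          fun j => Pi.single (Function.update w₀ i w j) 1 := by
        ext1 j
        by_cases h : j = i
        · subst h; simp
        · simp [Function.update_of_ne h, t]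
      rw [this]
      exact hprod _
  refine ⟨t, ?_⟩
  have hli : LinearIndependent ℂ fun o =>
      (⟨Pi.single (J o) 1, hmem o⟩ : LinearMap.range (blockTangent β t)) := by
    have h := (Pi.basisFun ℂ (Δ → N)).linearIndependent.comp J hinj
    refine LinearIndependent.of_comp (LinearMap.range (blockTangent β t)).subtype ?_
    convert h using 1
    ext o : 1
    simp
  rw [Nat.card_eq_fintype_card]
  exact hli.fintype_card_le_finrank

theorem isGeneric_finrank_range_blockTangent [Finite Δ] [Finite N] [∀ i, Finite (K i)] [Nonempty L]
    (β : (Σ i, K i) ≃ Δ) (w₀ : ∀ i, K i → N) :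
    IsGeneric {t : BlockArrays N K |
      finrank ℂ (LinearMap.range (blockTangent β t)) = Nat.card (NormalIndex w₀)} := by
  obtain ⟨t₀, ht₀⟩ := le_finrank_range_blockTangent β w₀
  obtain ⟨f, hf, hf0, hf1⟩ :=
    isGeneric_finrank_range_ge (blockTangent β) (isPolynomialMap_blockTangent β) t₀
  have h : IsGeneric {t : BlockArrays N K |
      finrank ℂ (LinearMap.range (blockTangent β t₀)) ≤
        finrank ℂ (LinearMap.range (blockTangent β t))} := ⟨f, hf, ⟨t₀, hf0⟩, hf1⟩
  exact (h.inter (isGeneric_forall_ne_zero w₀)).mono fun t ⟨h1, h2⟩ =>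
    le_antisymm (finrank_range_blockTangent_le β w₀ h2) (ht₀.trans h1)

end

/-! ### Slot automorphisms and irreducibility. -/

section Symmetries

variable {A : Type} [DecidableEq A] [DecidableEq N]

/-- The elementary matrix `E_{p,q}` acting on the slot `x` of an array. -/
def slotMap (x : A) (p q : N) : ((A → N) → ℂ) →ₗ[ℂ] ((A → N) → ℂ) where
  toFun T I := if I x = p then T (Function.update I x q) else 0
  map_add' T T' := by
    ext I
    simp only [Pi.add_apply]
    split_ifs <;> simp
  map_smul' z T := by
    ext I
    simp

theorem slotMap_apply (x : A) (p q : N) (T : (A → N) → ℂ) (I : A → N) :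
    slotMap x p q T I = if I x = p then T (Function.update I x q) else 0 := rfl

/-- For `p ≠ q` the map is unipotent; for `p = q` it doubles the entries with `I x = p`. -/
theorem injective_id_add_slotMap (x : A) (p q : N) :
    Function.Injective (LinearMap.id + slotMap x p q : ((A → N) → ℂ) →ₗ[ℂ] ((A → N) → ℂ)) := by
  rw [injective_iff_map_eq_zero]
  intro T hT
  have h : ∀ I, T I + (if I x = p then T (Function.update I x q) else 0) = 0 :=
    fun I => congrFun hT I
  have h1 : ∀ I, I x ≠ p → T I = 0 := fun I hI => by simpa [hI] using h I
  ext I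
  by_cases hI : I x = p
  · have h2 := h I
    rw [if_pos hI] at h2
    by_cases hpq : q = p
    · subst hpq
      rw [← hI, Function.update_eq_self, ← two_mul] at h2
      simpa using h2
    · rw [h1 (Function.update I x q) (by simpa using hpq), add_zero] at h2
      exact h2
  · exact h1 I hI

/-- The elementary automorphism `1 + E_{p,q}` acting on the slot `x` of an array. -/
noncomputable def slotEquiv [Finite A] [Finite N] (x : A) (p q : N) : ((A → N) → ℂ) ≃ₗ[ℂ] ((A → N) → ℂ) :=
  LinearEquiv.ofInjectiveEndo _ (injective_id_add_slotMap x p q)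

theorem slotEquiv_apply [Finite A] [Finite N] (x : A) (p q : N) (T : (A → N) → ℂ) :
    slotEquiv x p q T = T + slotMap x p q T := rfl

end Symmetries

section

variable [Fintype L] [DecidableEq L] [Finite N] [DecidableEq N] [Finite Δ] [DecidableEq Δ]
  [∀ i, Finite (K i)] [∀ i, DecidableEq (K i)]

/-- A slot automorphism acts on block products through the block that contains the slot. -/
theorem blockProduct_slotEquiv (β : (Σ i, K i) ≃ Δ) (i : L) (a : K i) (p q : N)
    (t : BlockArrays N K) :
    blockProduct β (fun j => Function.update
        (β := fun j => ((K j → N) → ℂ) ≃ₗ[ℂ] ((K j → N) → ℂ))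
        (fun _ => LinearEquiv.refl ℂ _) i (slotEquiv a p q) j (t j)) =
      slotEquiv (β ⟨i, a⟩) p q (blockProduct β t) := by
  ext I
  have h1 : ∀ j ≠ i, subword β (Function.update I (β ⟨i, a⟩) q) j = subword β I j := by
    intro j hj
    ext b
    have : β ⟨j, b⟩ ≠ β ⟨i, a⟩ := fun h => hj (congrArg Sigma.fst (β.injective h))
    simp [subword, Function.update_of_ne this]
  have h2 : subword β (Function.update I (β ⟨i, a⟩) q) i =
      Function.update (subword β I i) a q := by
    ext b
    by_cases hb : b = a
    · subst hb; simp [subword]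
    · have : β ⟨i, b⟩ ≠ β ⟨i, a⟩ := fun h => hb (by simpa using β.injective h)
      simp [subword, Function.update_of_ne this, Function.update_of_ne hb]
  rw [slotEquiv_apply, Pi.add_apply, slotMap_apply, blockProduct_apply, blockProduct_apply,
    blockProduct_apply, ← Finset.mul_prod_erase _ _ (Finset.mem_univ i),
    ← Finset.mul_prod_erase _ (fun j => t j (subword β I j)) (Finset.mem_univ i),
    ← Finset.mul_prod_erase _ (fun j => t j (subword β (Function.update I (β ⟨i, a⟩) q) j))
      (Finset.mem_univ i)]
  have h3 : ∏ j ∈ Finset.univ.erase i, t j (subword β (Function.update I (β ⟨i, a⟩) q) j) =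
      ∏ j ∈ Finset.univ.erase i, t j (subword β I j) :=
    Finset.prod_congr rfl fun j hj => by rw [h1 j (Finset.ne_of_mem_erase hj)]
  have h4 : ∏ j ∈ Finset.univ.erase i, Function.update
        (β := fun j => ((K j → N) → ℂ) ≃ₗ[ℂ] ((K j → N) → ℂ))
        (fun _ => LinearEquiv.refl ℂ _) i (slotEquiv a p q) j (t j) (subword β I j) =
      ∏ j ∈ Finset.univ.erase i, t j (subword β I j) :=
    Finset.prod_congr rfl fun j hj => by
      rw [Function.update_of_ne (Finset.ne_of_mem_erase hj)]; rfl
  rw [h3, h4, h2, Function.update_self, slotEquiv_apply, Pi.add_apply, slotMap_apply]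
  have h5 : subword β I i a = I (β ⟨i, a⟩) := rfl
  rw [h5]
  split_ifs <;> ring

/-- For every arrangement of the blocks a single slot lies in a single block, so the automorphism
can be moved onto that factor, for the product and then for its derivative. One automorphism
therefore serves all types at once, which permits mixed permutations. -/
theorem isSymmetry_slotEquiv {S : Type} (b : S → (Σ i, K i) ≃ Δ) (δ : Δ) (p q : N) :
    IsSymmetry (fun a => blockTangent (b a)) (slotEquiv δ p q) := by
  intro s
  obtain ⟨⟨i, a⟩, rfl⟩ := (b s).surjective δ
  set Γ : ∀ j, ((K j → N) → ℂ) ≃ₗ[ℂ] ((K j → N) → ℂ) :=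
    Function.update (fun _ => LinearEquiv.refl ℂ _) i (slotEquiv a p q) with hΓ
  have h1 : ∀ t, blockProduct (b s) (fun j => Γ j (t j)) =
      slotEquiv (b s ⟨i, a⟩) p q (blockProduct (b s) t) :=
    blockProduct_slotEquiv (b s) i a p q
  have h2 : ∀ t u, blockTangent (b s) (fun j => Γ j (t j)) (fun j => Γ j (u j)) =
      slotEquiv (b s ⟨i, a⟩) p q (blockTangent (b s) t u) := by
    intro t u
    rw [blockTangent_apply, blockTangent_apply, map_sum]
    refine Finset.sum_congr rfl fun k _ => ?_
    rw [← h1]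
    congr 1
    ext1 j
    rw [Function.apply_update (fun j => Γ j)]
  have hsurj : Function.Surjective fun (t : BlockArrays N K) j => Γ j (t j) :=
    fun t => ⟨fun j => (Γ j).symm (t j), by simp⟩
  refine ⟨fun t j => Γ j (t j), hsurj, fun t => ?_⟩
  ext x
  constructor
  · rintro ⟨u, rfl⟩
    obtain ⟨u, rfl⟩ := hsurj u
    exact ⟨_, ⟨u, rfl⟩, (h2 t u).symm⟩
  · rintro ⟨_, ⟨u, rfl⟩, rfl⟩
    exact ⟨_, h2 t u⟩

/-- Arrays have no proper nonzero subspace stable under all elementary slot automorphisms. -/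
theorem eq_top_of_slotEquiv_mem {W : Submodule ℂ ((Δ → N) → ℂ)} (hW : W ≠ ⊥)
    (h : ∀ δ p q, ∀ T ∈ W, slotEquiv δ p q T ∈ W) : W = ⊤ := by
  have := Fintype.ofFinite Δ
  have := Fintype.ofFinite N
  obtain ⟨T, hT, hT0⟩ := Submodule.exists_mem_ne_zero_of_ne_bot hW
  obtain ⟨I₀, hI₀⟩ : ∃ I, T I ≠ 0 := by
    by_contra! h0
    exact hT0 (funext h0)
  have hslot : ∀ δ p q, ∀ T ∈ W, slotMap δ p q T ∈ W := by
    intro δ p q T hT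
    have h1 := h δ p q T hT
    rw [slotEquiv_apply] at h1
    exact (Submodule.add_mem_iff_right W hT).1 h1
  -- Composes the elementary matrices `E_{J δ, I₀ δ}` over the slots in `A`. With all slots used,
  -- only `T I₀` times the unit array at `J` remains.
  have hmem : ∀ (J : Δ → N) (A : Finset Δ), (fun I => if ∀ δ ∈ A, I δ = J δ then
      T (fun δ => if δ ∈ A then I₀ δ else I δ) else 0) ∈ W := by
    intro J A
    induction A using Finset.induction_on with
    | empty => simpa using hT
    | insert δ A hδ ih =>
      convert hslot δ (J δ) (I₀ δ) _ ih using 1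
      ext I
      rw [slotMap_apply]
      by_cases hI : I δ = J δ
      · have h1 : (∀ δ' ∈ A, Function.update I δ (I₀ δ) δ' = J δ') ↔ ∀ δ' ∈ A, I δ' = J δ' := by
          refine forall₂_congr fun δ' hδ' => ?_
          rw [Function.update_of_ne]
          rintro rfl
          exact hδ hδ'
        have h2 : (fun δ' => if δ' ∈ insert δ A then I₀ δ' else I δ') =
            fun δ' => if δ' ∈ A then I₀ δ' else Function.update I δ (I₀ δ) δ' := by
          ext δ'
          by_cases h3 : δ' = δ
          · subst h3; simp [hδ]
          · simp [h3]
        simp only [Finset.forall_mem_insert, hI, true_and, if_true, h1, h2]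
      · simp [hI]
  have hsingle : ∀ J, (Pi.single J 1 : (Δ → N) → ℂ) ∈ W := by
    intro J
    have h1 := W.smul_mem (T I₀)⁻¹ (hmem J Finset.univ)
    convert h1 using 1
    ext I
    by_cases hI : I = J
    · subst hI
      simp [hI₀]
    · have : ¬ ∀ δ, I δ = J δ := fun h => hI (funext h)
      simp [hI, this]
  rw [eq_top_iff]
  intro X _
  have : X = ∑ J, X J • (Pi.single J 1 : (Δ → N) → ℂ) := by
    ext I
    simp [Finset.sum_apply, Pi.single_apply]
  rw [this]
  exact sum_mem fun J _ => W.smul_mem _ (hsingle J)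

end

theorem isIrreducibleFamily_blockTangent [Fintype L] [DecidableEq L] [Nonempty L] [Finite N]
    [Finite Δ] [∀ i, Finite (K i)] {S : Type} (b : S → (Σ i, K i) ≃ Δ) (w₀ : ∀ i, K i → N) :
    IsIrreducibleFamily (fun a => blockTangent (N := N) (b a)) (Nat.card (NormalIndex w₀)) := by
  classical
  exact
    { polynomial := fun a u => isPolynomialMap_blockTangent (b a) u
      isGeneric_finrank_eq := fun a => isGeneric_finrank_range_blockTangent (b a) w₀
      irreducible := fun W hW h => eq_top_of_slotEquiv_mem hW fun δ p q =>
        h _ (isSymmetry_slotEquiv b δ p q) }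

end BlockProducts

/-! ### Coordinates of concatenation products of tensors. -/

section TensorCoordinates

/-- The coordinates of a tensor. -/
noncomputable def tensorCoord (n d : ℕ) : Tensors n d ≃ₗ[ℂ] ((Fin d → Fin n) → ℂ) :=
  (Basis.piTensorProduct fun _ : Fin d => Pi.basisFun ℂ (Fin n)).equivFun

variable {n d e : ℕ}

theorem tensorCoord_tprod (x : Fin d → Fin n → ℂ) (I : Fin d → Fin n) :
    tensorCoord n d (PiTensorProduct.tprod ℂ x) I = ∏ i, x i (I i) := by
  simp [tensorCoord]

theorem tensorCoord_one (I : Fin 0 → Fin n) :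
    tensorCoord n 0 (GradedMonoid.GOne.one : Tensors n 0) I = 1 := by
  rw [TensorPower.gOne_def, tensorCoord_tprod]
  simp

theorem tensorCoord_mul (a : Tensors n d) (b : Tensors n e) (I : Fin (d + e) → Fin n) :
    tensorCoord n (d + e) (GradedMonoid.GMul.mul a b) I =
      tensorCoord n d a (fun i => I (Fin.castAdd e i)) *
        tensorCoord n e b (fun i => I (Fin.natAdd d i)) := by
  rw [TensorPower.gMul_eq_coe_linearMap]
  induction a using PiTensorProduct.induction_on with
  | add x y hx hy => simp only [map_add, LinearMap.add_apply, Pi.add_apply, hx, hy, add_mul]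
  | smul_tprod r x =>
    induction b using PiTensorProduct.induction_on with
    | add x y hx hy => simp only [map_add, Pi.add_apply, hx, hy, mul_add]
    | smul_tprod s y =>
      simp only [map_smul, LinearMap.smul_apply, Pi.smul_apply, smul_eq_mul]
      rw [← TensorPower.gMul_eq_coe_linearMap, TensorPower.tprod_mul_tprod, tensorCoord_tprod,
        tensorCoord_tprod, tensorCoord_tprod, Fin.prod_univ_add]
      simp only [Fin.append_left, Fin.append_right]
      ring

/-- The coordinate of a homogeneous tensor at an initial segment of an infinite word. -/
noncomputable def wordCoord (x : GradedMonoid (Tensors n)) (w : ℕ → Fin n) : ℂ :=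
  tensorCoord n x.1 x.2 fun i => w i

theorem wordCoord_one (w : ℕ → Fin n) : wordCoord (1 : GradedMonoid (Tensors n)) w = 1 :=
  tensorCoord_one _

/-- With infinite words the second factor just reads a shifted word, so no casts between tensor
degrees arise. -/
theorem wordCoord_mul (x y : GradedMonoid (Tensors n)) (w : ℕ → Fin n) :
    wordCoord (x * y) w = wordCoord x w * wordCoord y fun a => w (x.1 + a) :=
  tensorCoord_mul x.2 y.2 _

theorem fst_prod_ofFn {m : ℕ} (f : Fin m → GradedMonoid (Tensors n)) :
    (List.ofFn f).prod.1 = ∑ j, (f j).1 := by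
  induction m with
  | zero => rfl
  | succ m ih =>
    rw [List.ofFn_succ, List.prod_cons, Fin.sum_univ_succ, ← ih]
    rfl

theorem wordCoord_prod_ofFn {m : ℕ} (f : Fin m → GradedMonoid (Tensors n)) (w : ℕ → Fin n) :
    wordCoord (List.ofFn f).prod w = ∏ j : Fin m,
      wordCoord (f j) fun a => w (∑ i : Fin j, (f (Fin.castLE j.2.le i)).1 + a) := by
  induction m generalizing w with
  | zero => simp [wordCoord_one]
  | succ m ih =>
    rw [List.ofFn_succ, List.prod_cons, wordCoord_mul, ih, Fin.prod_univ_succ]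
    congr 1
    · congr 1
      ext1 a
      congr 1
      exact (Nat.zero_add a).symm
    · refine Finset.prod_congr rfl fun j _ => ?_
      congr 1
      ext1 a
      congr 1
      have : ∑ i : Fin (j.succ : Fin (m + 1)), (f (Fin.castLE j.succ.2.le i)).1 =
          (f 0).1 + ∑ i : Fin j, (f (Fin.castLE j.2.le i).succ).1 :=
        Fin.sum_univ_succ (n := j) fun i => (f (Fin.castLE j.succ.2.le i)).1
      rw [this, add_assoc]

theorem exists_extend (hn : 1 ≤ n) (I : Fin d → Fin n) : ∃ w : ℕ → Fin n, (fun i : Fin d => w i) = I :=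
  ⟨fun a => if ha : a < d then I ⟨a, ha⟩ else ⟨0, hn⟩, by ext1 i; simp⟩

theorem GradedMonoid.mk_eq_iff_wordCoord (hn : 1 ≤ n) (T : Tensors n d)
    (x : GradedMonoid (Tensors n)) (hx : x.1 = d) :
    (GradedMonoid.mk d T : GradedMonoid (Tensors n)) = x ↔
      ∀ w, wordCoord (GradedMonoid.mk d T) w = wordCoord x w := by
  constructor
  · intro h w
    rw [h]
  · obtain ⟨e, X⟩ := x
    obtain rfl : e = d := hx
    intro h
    congr 1
    apply (tensorCoord n e).injective
    ext I
    obtain ⟨w, rfl⟩ := exists_extend hn I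
    exact h w

variable {l : ℕ} {k : Fin l → ℕ}

/-- The positions of the blocks of lengths `k i`, concatenated in the order given by `σ`. -/
noncomputable def blockEquiv (hsum : ∑ i, k i = d) (σ : Equiv.Perm (Fin l)) :
    (Σ i, Fin (k i)) ≃ Fin d :=
  (Equiv.sigmaCongrLeft (β := fun i => Fin (k i)) σ).symm.trans
    (finSigmaFinEquiv.trans (finCongr ((Equiv.sum_comp σ k).trans hsum)))

theorem blockEquiv_apply (hsum : ∑ i, k i = d) (σ : Equiv.Perm (Fin l)) (j : Fin l)
    (a : Fin (k (σ j))) : (blockEquiv hsum σ ⟨σ j, a⟩ : ℕ) =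
      ∑ i : Fin j, k (σ (Fin.castLE j.2.le i)) + a := by
  have : (Equiv.sigmaCongrLeft (β := fun i => Fin (k i)) σ).symm ⟨σ j, a⟩ = ⟨j, a⟩ := by
    rw [Equiv.symm_apply_eq]
    rfl
  simp only [blockEquiv, Equiv.trans_apply, this, finCongr_apply, Fin.val_cast]
  exact finSigmaFinEquiv_apply (n := fun j => k (σ j)) ⟨j, a⟩

/-- In coordinates the tensors in `P_{k,σ}` are the block products. -/
theorem partitionComponent_eq (hn : 1 ≤ n) (hsum : ∑ i, k i = d) (σ : Equiv.Perm (Fin l)) :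
    partitionComponent n d k σ = Set.range fun t : BlockArrays (Fin n) (fun i => Fin (k i)) =>
      (tensorCoord n d).symm (blockProduct (blockEquiv hsum σ) t) := by
  have key : ∀ (T : Tensors n d) (t : ∀ i, Tensors n (k i)),
      (GradedMonoid.mk d T : GradedMonoid (Tensors n)) =
        (List.ofFn fun j : Fin l =>
          (GradedMonoid.mk (k (σ j)) (t (σ j)) : GradedMonoid (Tensors n))).prod ↔
      tensorCoord n d T = blockProduct (blockEquiv hsum σ) fun i => tensorCoord n (k i) (t i) := by
    intro T t
    rw [GradedMonoid.mk_eq_iff_wordCoord hn T _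
      ((fst_prod_ofFn _).trans ((Equiv.sum_comp σ k).trans hsum))]
    have h : ∀ w : ℕ → Fin n, wordCoord (List.ofFn fun j : Fin l =>
          (GradedMonoid.mk (k (σ j)) (t (σ j)) : GradedMonoid (Tensors n))).prod w =
        blockProduct (blockEquiv hsum σ) (fun i => tensorCoord n (k i) (t i)) fun a => w a := by
      intro w
      rw [wordCoord_prod_ofFn, blockProduct_apply,
        ← Equiv.prod_comp σ fun i => tensorCoord n (k i) (t i) _]
      refine Finset.prod_congr rfl fun j _ => ?_
      show tensorCoord n (k (σ j)) (t (σ j)) _ = tensorCoord n (k (σ j)) (t (σ j)) _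
      refine congrArg (tensorCoord n (k (σ j)) (t (σ j))) (funext fun a => ?_)
      exact congrArg w (blockEquiv_apply hsum σ j a).symm
    simp only [h]
    constructor
    · intro h1
      ext I
      obtain ⟨w, rfl⟩ := exists_extend hn I
      exact h1 w
    · intro h1 w
      exact congrFun h1 _
  ext T
  constructor
  · rintro ⟨t, ht⟩
    exact ⟨_, (LinearEquiv.symm_apply_eq _).2 ((key T t).1 ht).symm⟩
  · rintro ⟨t, rfl⟩
    refine ⟨fun i => (tensorCoord n (k i)).symm (t i),
      (key _ fun i => (tensorCoord n (k i)).symm (t i)).2 ?_⟩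
    simp only [LinearEquiv.apply_symm_apply]

end TensorCoordinates

/-! ### Terracini's principle for sums of block products. -/

section BlockSums

open Module

variable {L N Δ S ι : Type} {K : L → Type} [Fintype L]

/-- Sums of block products, one for each index. -/
def blockSum [Fintype ι] (b : S → (Σ i, K i) ≃ Δ) (s : ι → S) (q : ι → BlockArrays N K) :
    (Δ → N) → ℂ :=
  ∑ i, blockProduct (b (s i)) (q i)

theorem isPolynomialMap_blockSum [Fintype ι] [Finite N] [Finite Δ] (b : S → (Σ i, K i) ≃ Δ)
    (s : ι → S) : IsPolynomialMap (blockSum (N := N) b s) := by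
  unfold blockSum
  refine IsPolynomialMap.sum _ fun i _ => isPolynomialMap_blockProduct _ fun j w => ?_
  exact dual_mem_polynomialFunctionAlgebra (LinearMap.proj w ∘ₗ
    LinearMap.proj (R := ℂ) (φ := fun i => (K i → N) → ℂ) j ∘ₗ
    LinearMap.proj (R := ℂ) (φ := fun _ : ι => BlockArrays N K) i)

theorem exists_blockProduct_eq_normalBlockProduct (β : (Σ i, K i) ≃ Δ) (w₀ : ∀ i, K i → N) [Nonempty L]
    (z : NormalIndex w₀ → ℂ) : ∃ t, blockProduct β t = normalBlockProduct β w₀ z := by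
  classical
  obtain ⟨i⟩ := ‹Nonempty L›
  refine ⟨Function.update (normalArrays w₀ z) i (z none • normalArrays w₀ z i), ?_⟩
  rw [MultilinearMap.map_update_smul, Function.update_eq_self]
  rfl

/-- The normalised parametrization misses only products with a vanishing base entry in every
representation; nonvanishing is generic, so its image is still dense in `Z` and `c` parameters
suffice. -/
theorem varietyDim_le_card_normalIndex [Nonempty L] [Finite N] [Finite Δ]
    [∀ i, Finite (K i)] (β : (Σ i, K i) ≃ Δ) (w₀ : ∀ i, K i → N)
    {V : Type} [AddCommGroup V] [Module ℂ V] (κ : ((Δ → N) → ℂ) ≃ₗ[ℂ] V) {Z : Set V}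
    (h1 : ∀ t, κ (blockProduct β t) ∈ Z)
    (h2 : Z ⊆ zariskiClosure (Set.range fun t => κ (blockProduct β t))) :
    varietyDim Z ≤ Nat.card (NormalIndex w₀) := by
  classical
  have := Fintype.ofFinite (NormalIndex w₀)
  have : FiniteDimensional ℂ V := κ.finiteDimensional
  have hpol := κ.toLinearMap.isPolynomialMap.comp (isPolynomialMap_normalBlockProduct β w₀)
  have hpol2 : IsPolynomialMap fun t : BlockArrays N K => κ (blockProduct β t) :=
    κ.toLinearMap.isPolynomialMap.comp (isPolynomialMap_blockProduct β fun i w =>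
      apply_mem_polynomialFunctionAlgebra i w)
  have h := varietyDim_le_of_subset_zariskiClosure_range hpol (Z := Z) (fun z => by
    obtain ⟨t, ht⟩ := exists_blockProduct_eq_normalBlockProduct β w₀ z
    rw [← ht]
    exact h1 t) (fun v hv => mem_zariskiClosure_iff.2 fun f hf hz => by
      refine mem_zariskiClosure_iff.1 (h2 hv) f hf ?_
      rintro _ ⟨t, rfl⟩
      by_contra hne
      have hg : IsGeneric {t : BlockArrays N K | f (κ (blockProduct β t)) ≠ 0} :=
        ⟨_, hpol2.comp_mem hf, ⟨t, hne⟩, fun _ h => h⟩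
      obtain ⟨t', h3, h4⟩ := (hg.inter (isGeneric_forall_ne_zero w₀)).nonempty
      obtain ⟨z, hz'⟩ := exists_normalBlockProduct_eq β w₀ h4
      refine h3 ?_
      rw [← hz']
      exact hz _ ⟨z, rfl⟩)
  rwa [finrank_fintype_fun_eq_card, ← Nat.card_eq_fintype_card] at h

variable [DecidableEq L] [Fintype ι] [Fintype N] [Fintype Δ] [DecidableEq Δ]
  [∀ i, Fintype (K i)] [∀ i, DecidableEq (K i)]

theorem hasStrictFDerivAt_blockProduct (β : (Σ i, K i) ≃ Δ) (t : BlockArrays N K) :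
    HasStrictFDerivAt (fun t : BlockArrays N K => blockProduct β t)
      (LinearMap.toContinuousLinearMap (blockTangent β t)) t := by
  let f : ContinuousMultilinearMap ℂ (fun i => (K i → N) → ℂ) ((Δ → N) → ℂ) :=
    { blockProduct β with
      cont := by
        refine continuous_pi fun I => ?_
        show Continuous fun t : BlockArrays N K => ∏ i, t i (subword β I i)
        fun_prop }
  have h := f.hasStrictFDerivAt t
  refine h.congr_fderiv (ContinuousLinearMap.ext fun u => ?_)
  rw [ContinuousMultilinearMap.linearDeriv_apply]
  exact (blockTangent_apply β t u).symm

theorem hasStrictFDerivAt_blockSum (b : S → (Σ i, K i) ≃ Δ) (s : ι → S)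
    (q : ι → BlockArrays N K) :
    HasStrictFDerivAt (blockSum b s)
      (LinearMap.toContinuousLinearMap (sumTangentMap (fun a => blockTangent (b a)) s q)) q := by
  have h1 : ∀ i, HasStrictFDerivAt (fun q : ι → BlockArrays N K => blockProduct (b (s i)) (q i))
      ((LinearMap.toContinuousLinearMap (blockTangent (b (s i)) (q i))).comp
        (ContinuousLinearMap.proj i)) q := fun i =>
    (hasStrictFDerivAt_blockProduct (b (s i)) (q i)).comp q
      (ContinuousLinearMap.proj (R := ℂ) (φ := fun _ : ι => BlockArrays N K) i).hasStrictFDerivAt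
  have h2 := HasStrictFDerivAt.fun_sum (u := Finset.univ) fun i _ => h1 i
  refine h2.congr_fderiv (ContinuousLinearMap.ext fun u => ?_)
  simp [sumTangentMap_apply]

/-- Linear forms that are independent on a sum of tangent spaces are algebraically independent on
the set of sums of block products. -/
theorem eq_zero_of_eval_blockSum_eq_zero (b : S → (Σ i, K i) ≃ Δ) (s : ι → S)
    (q : ι → BlockArrays N K) {r : ℕ} (Λ : ((Δ → N) → ℂ) →ₗ[ℂ] (Fin r → ℂ))
    (hΛ : (tangentSum (fun a => blockTangent (b a)) s q).map Λ = ⊤) {Q : MvPolynomial (Fin r) ℂ}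
    (hQ : ∀ q, MvPolynomial.eval (Λ (blockSum b s q)) Q = 0) : Q = 0 := by
  refine MvPolynomial.eq_zero_of_hasStrictFDerivAt
    ((LinearMap.toContinuousLinearMap Λ).hasStrictFDerivAt.comp q
      (hasStrictFDerivAt_blockSum b s q)) ?_ hQ
  rw [← range_sumTangentMap, ← LinearMap.range_comp] at hΛ
  exact hΛ

/-- Where the tangent spaces span everything, the sum map is a submersion, so no nonzero polynomial
vanishes on its image. -/
theorem zariskiClosure_range_blockSum (b : S → (Σ i, K i) ≃ Δ) (s : ι → S)
    {V : Type} [AddCommGroup V] [Module ℂ V] (κ : ((Δ → N) → ℂ) ≃ₗ[ℂ] V)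
    (h : genericDim (fun a => blockTangent (N := N) (b a)) s = finrank ℂ ((Δ → N) → ℂ)) :
    zariskiClosure (Set.range fun q => κ (blockSum b s q)) = Set.univ := by
  have : FiniteDimensional ℂ V := κ.finiteDimensional
  obtain ⟨q, hq⟩ := exists_finrank_tangentSum_eq (D := fun a => blockTangent (N := N) (b a)) s
  rw [h] at hq
  have htop := Submodule.eq_top_of_finrank_eq hq
  refine Set.eq_univ_of_forall fun v => mem_zariskiClosure_iff.2 fun f hf hz => ?_
  rw [polynomialFunctionAlgebra_eq_range] at hf
  obtain ⟨Q, rfl⟩ := hf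
  let Λ₀ : V →ₗ[ℂ] (Fin (finrank ℂ (Dual ℂ V)) → ℂ) :=
    LinearMap.pi fun i => finBasis ℂ (Dual ℂ V) i
  have heval : ∀ v, MvPolynomial.aeval (R := ℂ) (fun i => (fun v => finBasis ℂ (Dual ℂ V) i v :
      V → ℂ)) Q v = MvPolynomial.eval (Λ₀ v) Q := by
    intro v
    exact MvPolynomial.comp_aeval_apply _ (Pi.evalAlgHom ℂ (fun _ : V => ℂ) v) Q
  have hinj : Function.Injective Λ₀ := by
    rw [injective_iff_map_eq_zero]
    intro v hv
    rw [← Module.forall_dual_apply_eq_zero_iff ℂ]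
    intro φ
    rw [← (finBasis ℂ (Dual ℂ V)).sum_repr φ, LinearMap.sum_apply]
    refine Finset.sum_eq_zero fun i _ => ?_
    rw [LinearMap.smul_apply, show finBasis ℂ (Dual ℂ V) i v = 0 from congrFun hv i, smul_zero]
  have hsurj : Function.Surjective Λ₀ :=
    (LinearMap.injective_iff_surjective_of_finrank_eq_finrank
      (by rw [finrank_fin_fun, Subspace.dual_finrank_eq])).1 hinj
  have hQ : Q = 0 := by
    refine eq_zero_of_eval_blockSum_eq_zero b s q (Λ₀ ∘ₗ κ.toLinearMap) ?_ fun p => ?_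
    · rw [htop, Submodule.map_top, LinearMap.range_eq_top]
      exact hsurj.comp κ.surjective
    · exact (heval _).symm.trans (hz _ ⟨p, rfl⟩)
  simp [hQ]

/-- Coordinates on a tangent sum of maximal dimension, extended to the whole space by a projection,
are linear forms that are algebraically independent on the sums. -/
theorem genericDim_le_varietyDim (b : S → (Σ i, K i) ≃ Δ) (s : ι → S)
    {V : Type} [AddCommGroup V] [Module ℂ V] (κ : ((Δ → N) → ℂ) ≃ₗ[ℂ] V) {Z : Set V}
    (hZ : ∀ q, κ (blockSum b s q) ∈ Z) :
    (genericDim (fun a => blockTangent (N := N) (b a)) s : WithBot ℕ∞) ≤ varietyDim Z := by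
  have : FiniteDimensional ℂ V := κ.finiteDimensional
  obtain ⟨q, hq⟩ := exists_finrank_tangentSum_eq (D := fun a => blockTangent (N := N) (b a)) s
  set r := genericDim (fun a => blockTangent (N := N) (b a)) s
  set W := tangentSum (fun a => blockTangent (N := N) (b a)) s q with hW
  obtain ⟨π, hπ⟩ := W.subtype.exists_leftInverse_of_injective (Submodule.ker_subtype W)
  let Λ : ((Δ → N) → ℂ) →ₗ[ℂ] (Fin r → ℂ) := (finBasisOfFinrankEq ℂ W hq).equivFun.toLinearMap ∘ₗ π
  have hΛ : W.map Λ = ⊤ := by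
    rw [eq_top_iff]
    intro x _
    let w := (finBasisOfFinrankEq ℂ W hq).equivFun.symm x
    refine ⟨w, w.2, ?_⟩
    have : π w = w := LinearMap.congr_fun hπ w
    show (finBasisOfFinrankEq ℂ W hq).equivFun (π w) = x
    rw [this, LinearEquiv.apply_symm_apply]
  refine le_varietyDim_of_forall_eval_eq_zero
    (κ.toLinearMap.isPolynomialMap.comp (isPolynomialMap_blockSum b s)) hZ
    (fun i => LinearMap.proj i ∘ₗ Λ ∘ₗ κ.symm.toLinearMap) fun Q hQ => ?_
  refine eq_zero_of_eval_blockSum_eq_zero b s q Λ hΛ fun p => ?_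
  have := hQ p
  simpa using this

end BlockSums

/-! ### Irreducible components of a finite union. -/

section Components

variable {V : Type} [AddCommGroup V] [Module ℂ V]

/-- A component of a finite union of irreducible sets contains one of them as a dense subset. -/
theorem IsComponentOf.exists_subset_zariskiClosure {κ : Type*} [Finite κ] {C : κ → Set V}
    (hC : ∀ i, @IsIrreducible V (zariskiTopology V) (C i)) {Y : Set V}
    (hY : IsComponentOf Y (⋃ i, C i)) : ∃ i, C i ⊆ Y ∧ Y ⊆ zariskiClosure (C i) := by
  classical
  have := Fintype.ofFinite κ
  let := zariskiTopology V
  obtain ⟨⟨hYX, hYi⟩, hmax⟩ := hY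
  obtain ⟨_, hz, hYz⟩ := isIrreducible_iff_sUnion_isClosed.1 hYi
    (Finset.univ.image fun i => closure (C i))
    (by
      intro z hz
      obtain ⟨i, -, rfl⟩ := Finset.mem_image.1 hz
      exact isClosed_closure)
    (by
      intro y hy
      obtain ⟨i, hi⟩ := Set.mem_iUnion.1 (hYX hy)
      exact ⟨closure (C i), by simp, subset_closure hi⟩)
  obtain ⟨i, -, rfl⟩ := Finset.mem_image.1 hz
  refine ⟨i, ?_, hYz⟩
  -- The part of the union inside the closure of `C i` is irreducible and contains `Y`; maximality
  -- puts it, and so `C i`, inside `Y`.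
  have h1 : C i ⊆ closure (C i) ∩ ⋃ i, C i :=
    Set.subset_inter subset_closure (Set.subset_iUnion C i)
  have h2 : IsIrreducible (closure (C i) ∩ ⋃ i, C i) := by
    rw [← isIrreducible_iff_closure]
    have : closure (closure (C i) ∩ ⋃ i, C i) = closure (C i) :=
      (closure_minimal Set.inter_subset_left isClosed_closure).antisymm (closure_mono h1)
    rw [this]
    exact (hC i).closure
  exact h1.trans (hmax ⟨Set.inter_subset_right, h2⟩ (Set.subset_inter hYz hYX))

end Components

/-! ### The generic partition rank and the theorem. -/

section PartitionRank

open Module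

variable {n d l : ℕ} {k : Fin l → ℕ}

theorem setOf_sum_partitionRankOne (hn : 1 ≤ n) (hsum : ∑ i, k i = d) (r : ℕ) :
    {T : Tensors n d | ∃ t : Fin r → Tensors n d,
      (∀ j, t j ∈ partitionRankOne n d k) ∧ T = ∑ j, t j} =
    ⋃ s : Fin r → Equiv.Perm (Fin l), Set.range fun q =>
      (tensorCoord n d).symm (blockSum (blockEquiv hsum) s q) := by
  ext T
  simp only [Set.mem_ofPred_eq, Set.mem_iUnion, Set.mem_range, partitionRankOne,
    partitionComponent_eq hn hsum, blockSum, map_sum]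
  constructor
  · rintro ⟨t, ht, rfl⟩
    choose s q hq using ht
    exact ⟨s, q, Finset.sum_congr rfl fun i _ => hq i⟩
  · rintro ⟨s, q, rfl⟩
    exact ⟨_, fun j => ⟨s j, q j, rfl⟩, rfl⟩

theorem isPolynomialMap_symm_blockSum (hsum : ∑ i, k i = d) {r : ℕ}
    (s : Fin r → Equiv.Perm (Fin l)) : IsPolynomialMap fun q =>
      (tensorCoord n d).symm (blockSum (blockEquiv hsum) s q) :=
  (tensorCoord n d).symm.toLinearMap.isPolynomialMap.comp (isPolynomialMap_blockSum _ s)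

/-- The generic partition rank exists, and it is at most `r` once the sums of `r` elements of the
partition-rank-one variety are dense. -/
theorem exists_isGenericPartitionRank_le (hn : 1 ≤ n) (hsum : ∑ i, k i = d) {r : ℕ}
    (hr : zariskiClosure {T : Tensors n d | ∃ t : Fin r → Tensors n d,
      (∀ j, t j ∈ partitionRankOne n d k) ∧ T = ∑ j, t j} = Set.univ) :
    ∃ r' ≤ r, IsGenericPartitionRank n d k r' := by
  classical
  -- The generic rank is the least length whose sums are dense: one of finitely many images is then
  -- dense and contains an open set, while shorter sums avoid a generic set.
  obtain ⟨m, hm, hmin⟩ := Nat.findX (p := fun r => zariskiClosure {T : Tensors n d |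
    ∃ t : Fin r → Tensors n d, (∀ j, t j ∈ partitionRankOne n d k) ∧ T = ∑ j, t j} = Set.univ)
    ⟨r, hr⟩
  refine ⟨m, not_lt.1 fun h => hmin r h hr, ?_⟩
  have h1 : IsGeneric {T : Tensors n d | ∃ t : Fin m → Tensors n d,
      (∀ j, t j ∈ partitionRankOne n d k) ∧ T = ∑ j, t j} := by
    rw [setOf_sum_partitionRankOne hn hsum] at hm ⊢
    obtain ⟨s, hs⟩ := exists_zariskiClosure_eq_univ hm
    exact ((isPolynomialMap_symm_blockSum hsum s).isGeneric_range hs).mono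
      (Set.subset_iUnion (fun s : Fin m → Equiv.Perm (Fin l) => Set.range fun q =>
        (tensorCoord n d).symm (blockSum (blockEquiv hsum) s q)) s)
  have h2 := IsGeneric.iInter fun j : Fin m => isGeneric_compl_of_not_dense (hmin j j.2)
  obtain ⟨f, hf, ⟨v, hv⟩, hgen⟩ := h1.inter h2
  refine ⟨_, isOpen_zariski_ne_zero hf, ⟨v, hv⟩, fun T hT => ⟨(hgen T hT).1, fun s hs => ?_⟩⟩
  by_contra! hlt
  exact Set.mem_iInter.1 (hgen T hT).2 ⟨s, hlt⟩ hs

end PartitionRank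

theorem mainTheorem7 (n d l : ℕ) (hn : 1 ≤ n) (hd : 1 ≤ d) (k : Fin l → ℕ)
    (hk : ∀ i, 1 ≤ k i) (hsum : ∑ i, k i = d)
    (c : ℝ) (hc : c = (∑ i, (n : ℝ) ^ (k i)) - (l : ℝ) + 1) :
    (∃ r : ℕ, IsGenericPartitionRank n d k r ∧ (r : ℝ) ≤ (n : ℝ) ^ d / c + c) ∧
    (∀ r : ℕ, (r : ℝ) < (n : ℝ) ^ d / c - c → IsNondefective (partitionRankOne n d k) r) := by
  have hl : Nonempty (Fin l) := by
    by_contra h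
    rw [not_nonempty_iff] at h
    simp at hsum
    omega
  let w₀ : ∀ i, Fin (k i) → Fin n := fun _ _ => ⟨0, hn⟩
  set C := Nat.card (NormalIndex w₀) with hC
  have hcC : c = C := by
    have h := card_normalIndex w₀
    simp only [Nat.card_fin, Fintype.card_fin] at h
    have h' : (C : ℝ) + l = (∑ i, (n : ℝ) ^ (k i)) + 1 := by exact_mod_cast h
    rw [hc]
    linarith
  have hC1 : 1 ≤ C := Nat.card_pos
  have hcpos : 0 < c := by
    rw [hcC]
    exact_mod_cast hC1
  have hfin : Module.finrank ℂ ((Fin d → Fin n) → ℂ) = n ^ d := by simp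
  have hD := isIrreducibleFamily_blockTangent (blockEquiv hsum) w₀
  rw [← hC] at hD
  constructor
  · obtain ⟨m, s, hs, hm⟩ := hD.exists_genericDim_eq_finrank hC1
    have hdense := zariskiClosure_range_blockSum (blockEquiv hsum) s (tensorCoord n d).symm hs
    obtain ⟨r, hr, hgen⟩ := exists_isGenericPartitionRank_le (k := k) (r := m) hn hsum (by
      rw [setOf_sum_partitionRankOne hn hsum, ← Set.univ_subset_iff, ← hdense]
      exact @closure_mono _ (zariskiTopology _) _ _
        (Set.subset_iUnion (fun s : Fin m → Equiv.Perm (Fin l) => Set.range fun q =>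
          (tensorCoord n d).symm (blockSum (blockEquiv hsum) s q)) s))
    refine ⟨r, hgen, ?_⟩
    rw [hfin] at hm
    have h1 : c * m ≤ (n : ℝ) ^ d + c * c := by
      rw [hcC]
      exact_mod_cast hm
    have h2 : (r : ℝ) ≤ m := by exact_mod_cast hr
    rw [div_add' _ _ _ hcpos.ne', le_div_iff₀ hcpos]
    nlinarith
  · intro r hr Y hY hdef
    have hirr : ∀ σ, @IsIrreducible _ (zariskiTopology _) (partitionComponent n d k σ) := by
      intro σ
      rw [partitionComponent_eq hn hsum]
      exact IsPolynomialMap.isIrreducible_range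
        ((tensorCoord n d).symm.toLinearMap.isPolynomialMap.comp
        (isPolynomialMap_blockProduct _ fun i w =>
          apply_mem_polynomialFunctionAlgebra (K := fun i => Fin (k i)) i w))
    -- Only density of some `P_{k,σ}` in each component is needed: the inclusion bounds the join
    -- from below, the closure bounds `varietyDim (Y j)` by `C`.
    choose s hs1 hs2 using fun j => (hY j).exists_subset_zariskiClosure hirr
    have hlt : C * (Nat.card (Fin r) + C) < Module.finrank ℂ ((Fin d → Fin n) → ℂ) := by
      rw [hfin, Nat.card_fin]
      rw [lt_sub_iff_add_lt, lt_div_iff₀ hcpos, hcC] at hr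
      have : ((r : ℝ) + C) * C < (n : ℝ) ^ d := hr
      rw [mul_comm]
      exact_mod_cast this
    have hdim := hD.genericDim_eq_mul s hlt
    have hjoin := genericDim_le_varietyDim (blockEquiv hsum) s (tensorCoord n d).symm
      (Z := varietyJoin Y) fun q => subset_zariskiClosure _
        ⟨fun j => (tensorCoord n d).symm (blockProduct (blockEquiv hsum (s j)) (q j)),
          fun j => hs1 j (by
            rw [partitionComponent_eq hn hsum]
            exact ⟨q j, rfl⟩), by rw [blockSum, map_sum]⟩
    have hYdim : ∀ j, varietyDim (Y j) ≤ C := fun j => by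
      have h1 := hs1 j
      have h2 := hs2 j
      rw [partitionComponent_eq hn hsum] at h1 h2
      exact varietyDim_le_card_normalIndex (blockEquiv hsum (s j)) w₀ (tensorCoord n d).symm
        (fun t => h1 ⟨t, rfl⟩) h2
    refine absurd hdef (not_lt.2 ((min_le_left _ _).trans (le_trans ?_ hjoin)))
    refine (Finset.sum_le_sum fun j _ => hYdim j).trans ?_
    rw [hdim, Nat.card_fin]
    simp [mul_comm]
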